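/- Let $H=-\frac{d^2}{dx^2}+\mathrm{i}x^3$ act on $L^2(\mathbb{R})$ with domain $\mathcal D(H)=\mathcal D(p^2)\cap\mathcal D(x^3)$, where $p=-\mathrm{i}\,d/dx$, $\mathcal D(p^2)=\{\psi\in L^2 : \psi',\psi''\in L^2\}$ (weak derivatives) and $\mathcal D(x^3)=\{\psi\in L^2 : x^3\psi\in L^2\}$. All complex powers and arguments are principal. There is a unique function $f:\mathbb{C}\times\mathbb{C}\to\mathbb{C}$ such that for every $\lambda\in\mathbb{C}$ the function $f(\cdot,\lambda)$ is an entire solution of $-f''(z)+(z^3+\lambda)f(z)=0$, and such that for every $\varepsilon>0$ $$f(z,\lambda)=z^{-3/4}\mathrm{e}^{-(2/5)z^{5/2}}\bigl(1+O(z^{-1/2})\bigr)\qquad\text{as } z\to\infty \text{ within } |\arg z|\le 3\pi/5-\varepsilon,$$ uniformly for $\lambda$ in compact sets. Let $\omega=\mathrm{e}^{2\pi\mathrm{i}/5}$, $\alpha=\mathrm{e}^{\mathrm{i}\pi/10}$, and put $$f_\pm(z,\lambda)=f(\omega^{\mp1}z,\omega^{\mp3}\lambda),\qquad \psi_\pm(z,\lambda)=f(\pm\alpha^{\pm1}z,-\alpha^{\mp2}\lambda).$$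 For every $\lambda\in\mathbb{C}$ there is a unique $C(\lambda)\in\mathbb{C}$ (the Stokes coefficient) with $$f_-(z,\lambda)+\omega f_+(z,\lambda)=C(\lambda)f(z,\lambda)\qquad(z\in\mathbb{C}).$$ Moreover, the following hold. (i) For every $\lambda\in\mathbb{C}$: $\lambda$ is an eigenvalue of $H$ if and only if there is $\gamma\in\mathbb{C}$ with $\psi_-(z,\lambda)=\gamma\,\psi_+(z,\lambda)$ for all $z\in\mathbb{C}$. (ii) If $\lambda,\gamma\in\mathbb{C}$ satisfy $\psi_-(z,\lambda)=\gamma\,\psi_+(z,\lambda)$ for all $z\in\mathbb{C}$, then $\gamma=-\omega$ and $C(\lambda)=0$. (iii) If $\lambda$ is an eigenvalue of $H$, then $\psi_-(0,\lambda)=-\omega\,\psi_+(0,\lambda)$. Conversely, for every $\delta>0$ there is $R$ such that every $\lambda\in\mathbb{C}$ with $|\arg\lambda|\le\pi-\delta$, $|\lambda|\ge R$ and $\psi_-(0,\lambda)=-\omega\,\psi_+(0,\lambda)$ is an eigenvalue of $H$. -/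

import Mathlib

open MeasureTheory

noncomputable section

namespace CubicOscillator

/-! ### The operator `H = p² + i x³` on `L²(ℝ)` -/

/-- The Hilbert space `L²(ℝ)` of complex-valued functions. -/
abbrev L2R : Type := Lp ℂ 2 (volume : Measure ℝ)

/-- Test functions on the line: smooth real-valued functions with compact support. -/
def IsTestFunction (φ : ℝ → ℝ) : Prop :=
  ContDiff ℝ ((⊤ : ℕ∞) : WithTop ℕ∞) φ ∧ HasCompactSupport φ

/-- `v` is the weak (distributional) derivative of `u`. -/
def HasWeakDeriv (u v : L2R) : Prop :=
  ∀ φ : ℝ → ℝ, IsTestFunction φ →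
    ∫ x, ((deriv φ x : ℝ) : ℂ) * u x = -∫ x, (φ x : ℂ) * v x

theorem integrable_test_mul {χ : ℝ → ℝ} (hc : Continuous χ) (hs : HasCompactSupport χ)
    (u : L2R) : Integrable (fun x => (χ x : ℂ) * u x) := by
  have hu : LocallyIntegrable (fun x => u x) (volume : Measure ℝ) :=
    (Lp.memLp u).locallyIntegrable (by norm_num)
  have := hu.integrable_smul_left_of_hasCompactSupport hc hs
  simpa using this

theorem HasWeakDeriv.add {u v u' v' : L2R} (h : HasWeakDeriv u v) (h' : HasWeakDeriv u' v') :
    HasWeakDeriv (u + u') (v + v') := by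
  intro φ hφ
  have hd : Continuous (deriv φ) := hφ.1.continuous_deriv (by simp)
  have e1 : (fun x => ((deriv φ x : ℝ) : ℂ) * (u + u' : L2R) x) =ᵐ[volume]
      fun x => ((deriv φ x : ℝ) : ℂ) * u x + ((deriv φ x : ℝ) : ℂ) * u' x := by
    filter_upwards [Lp.coeFn_add u u'] with x hx
    rw [hx, Pi.add_apply, mul_add]
  have e2 : (fun x => (φ x : ℂ) * (v + v' : L2R) x) =ᵐ[volume]
      fun x => (φ x : ℂ) * v x + (φ x : ℂ) * v' x := by
    filter_upwards [Lp.coeFn_add v v'] with x hx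
    rw [hx, Pi.add_apply, mul_add]
  rw [integral_congr_ae e1, integral_congr_ae e2,
    integral_add (integrable_test_mul hd hφ.2.deriv u) (integrable_test_mul hd hφ.2.deriv u'),
    integral_add (integrable_test_mul hφ.1.continuous hφ.2 v)
      (integrable_test_mul hφ.1.continuous hφ.2 v'), h φ hφ, h' φ hφ]
  ring

theorem HasWeakDeriv.smul {u v : L2R} (c : ℂ) (h : HasWeakDeriv u v) :
    HasWeakDeriv (c • u) (c • v) := by
  intro φ hφ
  have e1 : (fun x => ((deriv φ x : ℝ) : ℂ) * (c • u : L2R) x) =ᵐ[volume]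
      fun x => c * (((deriv φ x : ℝ) : ℂ) * u x) := by
    filter_upwards [Lp.coeFn_smul c u] with x hx
    rw [hx, Pi.smul_apply, smul_eq_mul]; ring
  have e2 : (fun x => (φ x : ℂ) * (c • v : L2R) x) =ᵐ[volume]
      fun x => c * ((φ x : ℂ) * v x) := by
    filter_upwards [Lp.coeFn_smul c v] with x hx
    rw [hx, Pi.smul_apply, smul_eq_mul]; ring
  rw [integral_congr_ae e1, integral_congr_ae e2, integral_const_mul, integral_const_mul, h φ hφ]
  ring

theorem HasWeakDeriv.zero : HasWeakDeriv 0 0 := by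
  have e : ∀ χ : ℝ → ℝ, ∫ x, (χ x : ℂ) * (0 : L2R) x = 0 := by
    intro χ
    have : (fun x => (χ x : ℂ) * (0 : L2R) x) =ᵐ[volume] fun _ => (0 : ℂ) := by
      filter_upwards [Lp.coeFn_zero ℂ 2 (volume : Measure ℝ)] with x hx
      rw [hx]; simp
    rw [integral_congr_ae this]; simp
  intro φ _
  rw [e, e, neg_zero]

theorem HasWeakDeriv.eq_zero {v : L2R} (h : HasWeakDeriv 0 v) : v = 0 := by
  have hv : LocallyIntegrable (fun x => v x) (volume : Measure ℝ) :=
    (Lp.memLp v).locallyIntegrable (by norm_num)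
  have key : ∀ᵐ x : ℝ, v x = 0 := by
    refine ae_eq_zero_of_integral_contDiff_smul_eq_zero hv ?_
    intro φ h1 h2
    have h0 := h φ ⟨h1, h2⟩
    have e1 : (fun x => ((deriv φ x : ℝ) : ℂ) * (0 : L2R) x) =ᵐ[volume] fun _ => (0 : ℂ) := by
      filter_upwards [Lp.coeFn_zero ℂ 2 (volume : Measure ℝ)] with x hx
      rw [hx]; simp
    rw [integral_congr_ae e1] at h0
    simpa using h0.symm
  rw [Lp.eq_zero_iff_ae_eq_zero]
  exact key

/-- The graph of the momentum operator `p = -i d/dx`: pairs `(u, w)` of `L²` functions with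
`u' = i w` weakly. -/
def momentumGraph : Submodule ℂ (L2R × L2R) where
  carrier := {q | HasWeakDeriv q.1 (Complex.I • q.2)}
  add_mem' := by
    intro a b ha hb
    change HasWeakDeriv (a.1 + b.1) (Complex.I • (a.2 + b.2))
    rw [smul_add]
    exact HasWeakDeriv.add ha hb
  zero_mem' := by
    change HasWeakDeriv 0 (Complex.I • 0)
    rw [smul_zero]
    exact HasWeakDeriv.zero
  smul_mem' := by
    intro c a ha
    change HasWeakDeriv (c • a.1) (Complex.I • (c • a.2))
    rw [smul_comm]
    exact HasWeakDeriv.smul c ha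

/-- The graph of `p²`: pairs `(u, w)` such that `u ∈ D(p)`, `p u ∈ D(p)` and `w = p (p u)`. -/
def momentumSqGraph : Submodule ℂ (L2R × L2R) where
  carrier := {q | ∃ v : L2R, (q.1, v) ∈ momentumGraph ∧ (v, q.2) ∈ momentumGraph}
  add_mem' := by
    rintro a b ⟨v, h1, h2⟩ ⟨v', h1', h2'⟩
    exact ⟨v + v', momentumGraph.add_mem h1 h1', momentumGraph.add_mem h2 h2'⟩
  zero_mem' := ⟨0, momentumGraph.zero_mem, momentumGraph.zero_mem⟩
  smul_mem' := by
    rintro c a ⟨v, h1, h2⟩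
    exact ⟨c • v, momentumGraph.smul_mem c h1, momentumGraph.smul_mem c h2⟩

/-- The graph of the multiplication operator by `x³` on its maximal domain. -/
def cubeGraph : Submodule ℂ (L2R × L2R) where
  carrier := {q | ∀ᵐ x : ℝ, q.2 x = (x : ℂ) ^ 3 * q.1 x}
  add_mem' := by
    intro a b ha hb
    change ∀ᵐ x : ℝ, (a.2 + b.2 : L2R) x = (x : ℂ) ^ 3 * (a.1 + b.1 : L2R) x
    filter_upwards [ha, hb, Lp.coeFn_add a.2 b.2, Lp.coeFn_add a.1 b.1] with x h1 h2 h3 h4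
    rw [h3, h4, Pi.add_apply, Pi.add_apply, h1, h2, mul_add]
  zero_mem' := by
    change ∀ᵐ x : ℝ, (0 : L2R) x = (x : ℂ) ^ 3 * (0 : L2R) x
    filter_upwards [Lp.coeFn_zero ℂ 2 (volume : Measure ℝ)] with x hx
    rw [hx]; simp
  smul_mem' := by
    intro c a ha
    change ∀ᵐ x : ℝ, (c • a.2 : L2R) x = (x : ℂ) ^ 3 * (c • a.1 : L2R) x
    filter_upwards [ha, Lp.coeFn_smul c a.2, Lp.coeFn_smul c a.1] with x h1 h3 h4
    rw [h3, h4, Pi.smul_apply, Pi.smul_apply, h1, smul_eq_mul, smul_eq_mul]; ring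

/-- `p² = -d²/dx²` with domain `D(p²)`. -/
def momentumSq : L2R →ₗ.[ℂ] L2R := momentumSqGraph.toLinearPMap

/-- Multiplication by `x³` with domain `D(x³) = {ψ ∈ L² | x³ ψ ∈ L²}`. -/
def cubeMul : L2R →ₗ.[ℂ] L2R := cubeGraph.toLinearPMap

theorem momentumGraph_eq_zero {w : L2R} (h : ((0 : L2R), w) ∈ momentumGraph) : w = 0 := by
  have h' : Complex.I • w = 0 := HasWeakDeriv.eq_zero h
  simpa using h'

/-- The relation defining `p²` is the graph of `momentumSq`. -/
theorem momentumSq_graph : momentumSq.graph = momentumSqGraph := by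
  refine Submodule.toLinearPMap_graph_eq _ ?_
  rintro ⟨u, w⟩ ⟨v, h1, h2⟩ hu
  change u = 0 at hu
  change w = 0
  subst hu
  have hv : v = 0 := momentumGraph_eq_zero h1
  subst hv
  exact momentumGraph_eq_zero h2

/-- The relation defining multiplication by `x³` is the graph of `cubeMul`. -/
theorem cubeMul_graph : cubeMul.graph = cubeGraph := by
  refine Submodule.toLinearPMap_graph_eq _ ?_
  rintro ⟨u, w⟩ h hu
  change u = 0 at hu
  change w = 0
  subst hu
  rw [Lp.eq_zero_iff_ae_eq_zero]
  have h' : ∀ᵐ x : ℝ, w x = (x : ℂ) ^ 3 * (0 : L2R) x := h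
  filter_upwards [h', Lp.coeFn_zero ℂ 2 (volume : Measure ℝ)] with x h1 h2
  rw [h1, h2]; simp

/-- The imaginary cubic oscillator `H = p² + i x³`. The sum of partially defined operators has
the intersection of the domains as its domain, so `D(H) = D(p²) ∩ D(x³)`. -/
def hamiltonian : L2R →ₗ.[ℂ] L2R := momentumSq + Complex.I • cubeMul

/-- `lam` is an eigenvalue of the partially defined operator `T`. -/
def IsEigenvalue (T : L2R →ₗ.[ℂ] L2R) (lam : ℂ) : Prop :=
  ∃ ψ : T.domain, (ψ : L2R) ≠ 0 ∧ T ψ = lam • (ψ : L2R)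

/-! ### The solution decaying in the sector `|arg z| < π/5`, and its rotations -/

/-- The leading asymptotic term `z^{-3/4} exp(-(2/5) z^{5/2})`, with principal branches. -/
def leadingTerm (z : ℂ) : ℂ :=
  z ^ (-(3 / 4) : ℂ) * Complex.exp (-(2 / 5) * z ^ (5 / 2 : ℂ))

/-- `f(·, lam)` is for every `lam` an entire solution of `-f'' + (z³ + lam) f = 0`, and
`f(z, lam) = z^{-3/4} exp(-(2/5) z^{5/2}) (1 + O(z^{-1/2}))` as `z → ∞` in
`|arg z| ≤ 3π/5 - ε`, for every `ε > 0`, uniformly for `lam` in compact sets. -/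
structure IsSubdominantSolution (f : ℂ → ℂ → ℂ) : Prop where
  entire : ∀ lam : ℂ, Differentiable ℂ (fun z => f z lam)
  ode : ∀ lam z : ℂ, -iteratedDeriv 2 (fun w => f w lam) z + (z ^ 3 + lam) * f z lam = 0
  asymptotics : ∀ ε : ℝ, 0 < ε → ∀ K : Set ℂ, IsCompact K →
    ∃ M R : ℝ, ∀ lam ∈ K, ∀ z : ℂ, R ≤ ‖z‖ → |z.arg| ≤ 3 * Real.pi / 5 - ε →
      ∃ r : ℂ, f z lam = leadingTerm z * (1 + r) ∧ ‖r‖ ≤ M * ‖z‖ ^ (-(1 / 2) : ℝ)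

/-- `ω = e^{2πi/5}`. -/
def omega : ℂ := Complex.exp (2 * Real.pi * Complex.I / 5)

/-- `α = e^{iπ/10}`. -/
def alpha : ℂ := Complex.exp (Complex.I * Real.pi / 10)

/-- `f₊(z, lam) = f(ω⁻¹ z, ω⁻³ lam)`. -/
def fPlus (f : ℂ → ℂ → ℂ) (z lam : ℂ) : ℂ := f (omega⁻¹ * z) ((omega ^ 3)⁻¹ * lam)

/-- `f₋(z, lam) = f(ω z, ω³ lam)`. -/
def fMinus (f : ℂ → ℂ → ℂ) (z lam : ℂ) : ℂ := f (omega * z) (omega ^ 3 * lam)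

/-- `ψ₊(z, lam) = f(α z, -α⁻² lam)`. -/
def psiPlus (f : ℂ → ℂ → ℂ) (z lam : ℂ) : ℂ := f (alpha * z) (-(alpha ^ 2)⁻¹ * lam)

/-- `ψ₋(z, lam) = f(-α⁻¹ z, -α² lam)`. -/
def psiMinus (f : ℂ → ℂ → ℂ) (z lam : ℂ) : ℂ := f (-alpha⁻¹ * z) (-alpha ^ 2 * lam)

end CubicOscillator

end

namespace CubicOscillator

open Filter Topology Set ComplexConjugate

/-! ### Integration along horizontal rays -/

/-! The ray arg z = π/5 is an oscillatory direction of the equation. The rotation z = α²y gives F''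
= (ωλ − y³)F, and the Liouville-Green substitution η = (2/5)y^{5/2}, F = y^{-3/4} e^{-iη} M(η) gives
M'' − 2iM' = VM with V = O(|η|^{-6/5}). The solution with M → 1 is the fixed point of an integral
operator along the rays η + s, s > 0, with kernel (1 − e^{-2is})/(2i) of modulus at most 1. These
rays stay inside `farRegion`, which surrounds the cut of the η-plane, so a single iteration
(`exists_jost`) controls both the decaying and the growing directions. Constant Wronskians with two
entire power series solutions then continue the result to an entire function
(`exists_isJostSolution`); rotated back and normalized, it is `upper`, the required f.

The conjugate Jost solution behaves like e^{iη}. Its Wronskian with the first is 2i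
(`jost_wronskian`), which yields a basis `upper`, `growing`. On the positive axis `growing`
dominates the leading term, so the asymptotics there already determine a solution
(`IsSol.eq_upper`). This gives uniqueness of f, its symmetry under conjugation, hence the lower half
of the sector, and the identity of `growing` with f₊.

Rotation shows W(f, f₋) = −ω W(f, f₊), so f₋ + ωf₊ is a multiple of f. As f and f₊ are independent,
f₋ = γf₊ forces γ = −ω and C = 0.

On the line z = ix the functions ψ₊ and ψ₋ are solutions of Hu = λu that decay at +∞ and −∞
respectively. The Wronskian of an L² eigenfunction with either is constant and integrable on a half
line, hence zero, so the two are proportional; conversely, proportionality produces a solution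
decaying at both ends. Finally, matching at the origin says C(λ) f(0, λ) = 0, and a zero λ of f(0,
·) is minus an eigenvalue of a positive Dirichlet problem, hence a non-positive real number. -/

/-- The weight `(R + |x|)^{-6/5}`, which dominates the potential on horizontal lines. -/
noncomputable def weight (R x : ℝ) : ℝ := (R + |x|) ^ (-(6 / 5) : ℝ)

theorem weight_nonneg {R : ℝ} (hR : 0 < R) (x : ℝ) : 0 ≤ weight R x := by
  unfold weight; positivity

theorem weight_anti {R S x y : ℝ} (hS : 0 < S) (h : S + |x| ≤ R + |y|) :
    weight R y ≤ weight S x := by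
  unfold weight
  exact Real.rpow_le_rpow_of_nonpos (by positivity) h (by norm_num)

/-- Each half line contributes 5R^{-1/5}. With R of the order of |η| ~ |z|^{5/2}, this power is the
source of the error O(z^{-1/2}). -/
theorem integral_weight {R : ℝ} (hR : 0 < R) : ∫ x, weight R x = 10 * R ^ (-(1 / 5) : ℝ) := by
  have h1 : ∫ x in Ioi (0 : ℝ), (x + R) ^ (-(6 / 5) : ℝ) = 5 * R ^ (-(1 / 5) : ℝ) := by
    have hd : ∀ x ∈ Ici (0 : ℝ), HasDerivAt (fun t : ℝ => -5 * (t + R) ^ (-(1 / 5) : ℝ))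
        ((x + R) ^ (-(6 / 5) : ℝ)) x := by
      intro x hx
      have hx' : (0 : ℝ) ≤ x := hx
      have := (((hasDerivAt_id x).add_const R).rpow_const (p := (-(1 / 5) : ℝ))
        (Or.inl (by simp; positivity))).const_mul (-5)
      refine this.congr_deriv ?_
      norm_num
      ring
    have hlim : Tendsto (fun t : ℝ => -5 * (t + R) ^ (-(1 / 5) : ℝ)) atTop (𝓝 (-5 * 0)) :=
      ((tendsto_rpow_neg_atTop (by norm_num : (0 : ℝ) < 1 / 5)).comp
        (tendsto_atTop_add_const_right _ R tendsto_id)).const_mul _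
    rw [integral_Ioi_of_hasDerivAt_of_tendsto' hd
      (integrableOn_add_rpow_Ioi_of_lt (by norm_num) (by linarith)) hlim]
    simp
  have h2 := integral_comp_abs (f := fun x => (x + R) ^ (-(6 / 5) : ℝ))
  rw [h1] at h2
  simp only [weight]
  simp_rw [add_comm R]
  rw [h2]; ring

theorem integrable_weight {R : ℝ} (hR : 0 < R) : Integrable (weight R) := by
  -- A non-integrable function has integral 0 by convention, while the value computed above is
  -- positive.
  by_contra h
  have h1 := integral_weight hR
  rw [integral_undef h] at h1
  have : 0 < R ^ (-(1 / 5) : ℝ) := by positivity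
  linarith

theorem integrable_weight_shift {R : ℝ} (hR : 0 < R) (a : ℝ) :
    Integrable (fun s => weight R (a + s)) (volume.restrict (Ioi 0)) :=
  ((integrable_weight hR).comp_add_left a).integrableOn

theorem integral_weight_shift_le {R : ℝ} (hR : 0 < R) (a : ℝ) :
    ∫ s in Ioi (0 : ℝ), weight R (a + s) ≤ 10 * R ^ (-(1 / 5) : ℝ) := by
  rw [← integral_weight hR, ← integral_add_left_eq_self (weight R) a]
  exact setIntegral_le_integral ((integrable_weight hR).comp_add_left a)
    (Eventually.of_forall fun x => weight_nonneg hR _)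

theorem tendsto_weight_shift {R : ℝ} (a : ℝ) :
    Tendsto (fun s => weight R (a + s)) atTop (𝓝 0) := by
  unfold weight
  refine (tendsto_rpow_neg_atTop (by norm_num : (0 : ℝ) < 6 / 5)).comp ?_
  exact tendsto_atTop_add_const_left _ R
    (tendsto_abs_atTop_atTop.comp (tendsto_atTop_add_const_left _ a tendsto_id))

/-- The set of `η` with `R < Re η` or `R < |Im η|`; it is stable under translations to the right. -/
def farRegion (R : ℝ) : Set ℂ := {η | R < max η.re |η.im|}

theorem isOpen_farRegion (R : ℝ) : IsOpen (farRegion R) :=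
  isOpen_lt continuous_const (Complex.continuous_re.max Complex.continuous_im.abs)

theorem farRegion_anti {R S : ℝ} (h : R ≤ S) : farRegion S ⊆ farRegion R :=
  fun _ hη => lt_of_le_of_lt h hη

theorem add_mem_farRegion {R : ℝ} {η : ℂ} (h : η ∈ farRegion R) {s : ℝ} (hs : 0 ≤ s) :
    η + s ∈ farRegion R := by
  simp only [farRegion, mem_ofPred_eq, lt_max_iff, Complex.add_re, Complex.ofReal_re,
    Complex.add_im, Complex.ofReal_im, add_zero] at h ⊢
  exact h.imp_left fun h => by linarith

/-- The right half plane meets both the upper and the lower one. Connectedness makes a Wronskian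
with zero derivative a single constant on the whole region. -/
theorem isPreconnected_farRegion (R : ℝ) : IsPreconnected (farRegion R) := by
  have h1 : IsPreconnected {η : ℂ | R < η.im} := (convex_halfSpace_im_gt R).isPreconnected
  have h2 : IsPreconnected {η : ℂ | R < η.re} := (convex_halfSpace_re_gt R).isPreconnected
  have h3 : IsPreconnected {η : ℂ | η.im < -R} := (convex_halfSpace_im_lt (-R)).isPreconnected
  have h12 := IsPreconnected.union (⟨R + 1, R + 1⟩ : ℂ) (by simp) (by simp) h1 h2
  have h123 := IsPreconnected.union (⟨R + 1, -R - 1⟩ : ℂ) (by simp) (by simp) h12 h3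
  convert h123 using 1
  ext η
  simp only [farRegion, mem_ofPred_eq, lt_max_iff, lt_abs, mem_union]
  constructor
  · rintro (h | h | h)
    · exact Or.inl (Or.inr h)
    · exact Or.inl (Or.inl h)
    · exact Or.inr (by linarith)
  · rintro ((h | h) | h)
    · exact Or.inr (Or.inl h)
    · exact Or.inl h
    · exact Or.inr (Or.inr (by linarith))

theorem norm_ge_of_mem_farRegion {R : ℝ} {η : ℂ} (h : η ∈ farRegion R) :
    (R + |η.re|) / 2 ≤ ‖η‖ := by
  have h1 := Complex.abs_re_le_norm η
  have h2 := Complex.abs_im_le_norm η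
  have h3 := le_abs_self η.re
  rcases lt_max_iff.1 (show R < max η.re |η.im| from h) with h | h <;> linarith

theorem mem_slitPlane_of_mem_farRegion {R : ℝ} (hR : 0 ≤ R) {η : ℂ} (h : η ∈ farRegion R) :
    η ∈ Complex.slitPlane := by
  rw [Complex.mem_slitPlane_iff]
  rcases lt_max_iff.1 (show R < max η.re |η.im| from h) with h | h
  · exact Or.inl (by linarith)
  · exact Or.inr (abs_pos.1 (by linarith))

/-- `∫₀^∞ e^{-2ics} F(η + s) ds`. -/
noncomputable def rayIntegral (c : ℝ) (F : ℂ → ℂ) (η : ℂ) : ℂ :=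
  ∫ s in Ioi (0 : ℝ), Complex.exp (-(2 * Complex.I * c) * s) * F (η + s)

theorem norm_exp_ray (c s : ℝ) : ‖Complex.exp (-(2 * Complex.I * c) * s)‖ = 1 := by
  rw [Complex.norm_exp]; simp

/-- `F` is holomorphic on `farRegion R` and dominated there by a multiple of the weight. -/
structure DominatedOn (R B : ℝ) (F : ℂ → ℂ) : Prop where
  differentiableOn : DifferentiableOn ℂ F (farRegion R)
  norm_le : ∀ η ∈ farRegion R, ‖F η‖ ≤ B * weight R η.re

theorem continuousOn_ray {R : ℝ} {F : ℂ → ℂ} (hF : ContinuousOn F (farRegion R)) {η : ℂ}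
    (hη : η ∈ farRegion R) (c : ℝ) :
    ContinuousOn (fun s : ℝ => Complex.exp (-(2 * Complex.I * c) * s) * F (η + s)) (Ici 0) := by
  refine ContinuousOn.mul (by fun_prop) ?_
  exact hF.comp (by fun_prop) fun s hs => add_mem_farRegion hη hs

theorem integrable_ray {R B : ℝ} (hR : 0 < R) {F : ℂ → ℂ} (hF : DominatedOn R B F) {η : ℂ}
    (hη : η ∈ farRegion R) (c : ℝ) :
    IntegrableOn (fun s : ℝ => Complex.exp (-(2 * Complex.I * c) * s) * F (η + s)) (Ioi 0) := by
  refine Integrable.mono' ((integrable_weight_shift hR η.re).const_mul B)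
    (((continuousOn_ray hF.differentiableOn.continuousOn hη c).mono
      Ioi_subset_Ici_self).aestronglyMeasurable measurableSet_Ioi) ?_
  refine (ae_restrict_mem measurableSet_Ioi).mono fun s hs => ?_
  rw [norm_mul, norm_exp_ray, one_mul]
  simpa using hF.norm_le _ (add_mem_farRegion hη (le_of_lt hs))

theorem norm_rayIntegral_le {R B : ℝ} (hR : 0 < R) (hB : 0 ≤ B) {F : ℂ → ℂ}
    (hF : ∀ η ∈ farRegion R, ‖F η‖ ≤ B * weight R η.re) {η : ℂ}
    (hη : η ∈ farRegion R) (c : ℝ) :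
    ‖rayIntegral c F η‖ ≤ B * (10 * R ^ (-(1 / 5) : ℝ)) := by
  refine (norm_integral_le_of_norm_le ((integrable_weight_shift hR η.re).const_mul B) ?_).trans ?_
  · refine (ae_restrict_mem measurableSet_Ioi).mono fun s hs => ?_
    rw [norm_mul, norm_exp_ray, one_mul]
    simpa using hF _ (add_mem_farRegion hη (le_of_lt hs))
  · rw [integral_const_mul]
    exact mul_le_mul_of_nonneg_left (integral_weight_shift_le hR _) hB

/-- Cauchy's estimate on discs of a fixed radius dominates F' by a weight, which permits
differentiation under the integral. Integrating by parts in s then removes F' and leaves the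
boundary term −F(η). -/
theorem hasDerivAt_rayIntegral {R B : ℝ} (hR : 0 < R) (hB : 0 ≤ B) {F : ℂ → ℂ}
    (hF : DominatedOn R B F) {η : ℂ} (hη : η ∈ farRegion R) (c : ℝ) :
    HasDerivAt (rayIntegral c F) (2 * Complex.I * c * rayIntegral c F η - F η) η := by
  obtain ⟨ε, hε, hball⟩ := Metric.isOpen_iff.1 (isOpen_farRegion R) η hη
  -- The bound ε/4 keeps the disc of radius 2r inside the region; R/8 makes a displacement by 2r
  -- cost at most R/2, so that `weight R` is replaced by `weight (R / 2)`.
  set r : ℝ := min (ε / 4) (R / 8) with hr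
  have hr0 : 0 < r := by positivity
  have hr1 : r ≤ ε / 4 := min_le_left _ _
  have hr2 : r ≤ R / 8 := min_le_right _ _
  have hin : ∀ z ∈ Metric.closedBall η (2 * r), ∀ s : ℝ, 0 ≤ s → z + s ∈ farRegion R := by
    intro z hz s hs
    refine add_mem_farRegion (hball ?_) hs
    rw [Metric.mem_closedBall] at hz
    rw [Metric.mem_ball]; linarith
  have hderiv : ∀ z ∈ Metric.ball η r, ∀ s : ℝ, 0 ≤ s →
      ‖deriv F (z + s)‖ ≤ B * weight (R / 2) (η.re + s) / r := by
    intro z hz s hs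
    rw [Metric.mem_ball] at hz
    have key : ∀ w ∈ Metric.closedBall (z + s) r, w - s ∈ Metric.closedBall η (2 * r) := by
      intro w hw
      rw [Metric.mem_closedBall, dist_eq_norm] at hw ⊢
      rw [dist_eq_norm] at hz
      calc ‖w - s - η‖ = ‖(w - (z + s)) + (z - η)‖ := by ring_nf
        _ ≤ _ := (norm_add_le _ _).trans (by linarith)
    have hsub : Metric.closedBall (z + s) r ⊆ farRegion R := by
      intro w hw
      simpa using hin _ (key w hw) s hs
    refine Complex.norm_deriv_le_of_forall_mem_sphere_norm_le hr0
      (hF.differentiableOn.diffContOnCl_ball hsub) fun w hw => ?_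
    have hw' := Metric.sphere_subset_closedBall hw
    refine (hF.norm_le w (hsub hw')).trans (mul_le_mul_of_nonneg_left ?_ hB)
    refine weight_anti (by positivity) ?_
    have h1 := key w hw'
    rw [Metric.mem_closedBall, dist_eq_norm] at h1
    have h2 := (Complex.abs_re_le_norm _).trans h1
    simp only [Complex.sub_re, Complex.ofReal_re] at h2
    have h3 : |η.re + s| ≤ |w.re| + |w.re - s - η.re| := by
      have : η.re + s = w.re - (w.re - s - η.re) := by ring
      rw [this]; exact abs_sub _ _
    linarith
  have hmeas : ∀ z ∈ Metric.ball η r, AEStronglyMeasurable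
      (fun s : ℝ => Complex.exp (-(2 * Complex.I * c) * s) * F (z + s))
      (volume.restrict (Ioi 0)) := by
    intro z hz
    refine ((continuousOn_ray hF.differentiableOn.continuousOn ?_ c).mono
      Ioi_subset_Ici_self).aestronglyMeasurable measurableSet_Ioi
    have := hin z (Metric.mem_closedBall.2 (by rw [Metric.mem_ball] at hz; linarith)) 0 le_rfl
    simpa using this
  have hdF : DifferentiableOn ℂ (deriv F) (farRegion R) :=
    hF.differentiableOn.deriv (isOpen_farRegion R)
  have hF' : ∀ z ∈ farRegion R, HasDerivAt F (deriv F z) z := fun z hz =>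
    ((hF.differentiableOn z hz).differentiableAt ((isOpen_farRegion R).mem_nhds hz)).hasDerivAt
  have main := hasDerivAt_integral_of_dominated_loc_of_deriv_le (μ := volume.restrict (Ioi (0 : ℝ)))
    (F := fun z (s : ℝ) => Complex.exp (-(2 * Complex.I * c) * s) * F (z + s))
    (F' := fun z (s : ℝ) => Complex.exp (-(2 * Complex.I * c) * s) * deriv F (z + s))
    (x₀ := η) (s := Metric.ball η r) (bound := fun s => B * weight (R / 2) (η.re + s) / r)
    (Metric.ball_mem_nhds _ hr0)
    (by filter_upwards [Metric.ball_mem_nhds η hr0] with z hz using hmeas z hz)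
    (integrable_ray hR hF hη c)
    (((continuousOn_ray hdF.continuousOn hη c).mono
      Ioi_subset_Ici_self).aestronglyMeasurable measurableSet_Ioi)
    (by
      refine (ae_restrict_mem measurableSet_Ioi).mono fun s hs z hz => ?_
      rw [norm_mul, norm_exp_ray, one_mul]
      exact hderiv z hz s (le_of_lt hs))
    (((integrable_weight_shift (half_pos hR) η.re).const_mul B).div_const r)
    (by
      refine (ae_restrict_mem measurableSet_Ioi).mono fun s hs z hz => ?_
      have hz' : z + s ∈ farRegion R := hin z (Metric.ball_subset_closedBall
        (Metric.ball_subset_ball (by linarith) hz)) s (le_of_lt hs)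
      exact ((hF' _ hz').comp_add_const z (s : ℂ)).const_mul _)
  refine main.2.congr_deriv ?_
  have hparts := integral_Ioi_of_hasDerivAt_of_tendsto' (a := (0 : ℝ)) (m := (0 : ℂ))
    (f := fun s : ℝ => Complex.exp (-(2 * Complex.I * c) * s) * F (η + s))
    (f' := fun s : ℝ => -(2 * Complex.I * c) *
      (Complex.exp (-(2 * Complex.I * c) * s) * F (η + s)) +
      Complex.exp (-(2 * Complex.I * c) * s) * deriv F (η + s))
    (by
      intro s hs
      have hof : HasDerivAt (fun s : ℝ => (s : ℂ)) 1 s := Complex.ofRealCLM.hasDerivAt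
      have h1 : HasDerivAt (fun s : ℝ => Complex.exp (-(2 * Complex.I * c) * s))
          (Complex.exp (-(2 * Complex.I * c) * s) * (-(2 * Complex.I * c) * 1)) s :=
        (hof.const_mul _).cexp
      have h2 : HasDerivAt (fun s : ℝ => F (η + s)) (deriv F (η + s)) s := by
        exact ((hF' _ (add_mem_farRegion hη hs)).comp s (hof.const_add _)).congr_deriv (by simp)
      refine (h1.mul h2).congr_deriv ?_
      ring)
    (((integrable_ray hR hF hη c).const_mul _).add main.1)
    (by
      have hB0 : Tendsto (fun s => B * weight R (η.re + s)) atTop (𝓝 0) := by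
        simpa using (tendsto_weight_shift (R := R) η.re).const_mul B
      refine squeeze_zero_norm' ?_ hB0
      filter_upwards [eventually_ge_atTop (0 : ℝ)] with s hs
      rw [norm_mul, norm_exp_ray, one_mul]
      simpa using hF.norm_le _ (add_mem_farRegion hη hs))
  rw [integral_add ((integrable_ray hR hF hη c).const_mul _) main.1, integral_const_mul] at hparts
  simp only [Complex.ofReal_zero, mul_zero, Complex.exp_zero, one_mul, add_zero] at hparts
  unfold rayIntegral
  linear_combination hparts

theorem rayIntegral_sub {R B B' : ℝ} (hR : 0 < R) {F G : ℂ → ℂ} (hF : DominatedOn R B F)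
    (hG : DominatedOn R B' G) {η : ℂ} (hη : η ∈ farRegion R) (c : ℝ) :
    rayIntegral c F η - rayIntegral c G η = rayIntegral c (fun z => F z - G z) η := by
  unfold rayIntegral
  rw [← integral_sub (integrable_ray hR hF hη c) (integrable_ray hR hG hη c)]
  simp only [mul_sub]

/-! ### Jost solutions by successive approximation -/

theorem DominatedOn.mul {R B K : ℝ} (hR : 0 < R) (hB : 0 ≤ B) {V M : ℂ → ℂ}
    (hV : DominatedOn R B V)
    (hM : DifferentiableOn ℂ M (farRegion R)) (hK : ∀ η ∈ farRegion R, ‖M η‖ ≤ K) :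
    DominatedOn R (B * K) (fun η => V η * M η) where
  differentiableOn := hV.differentiableOn.mul hM
  norm_le η hη := by
    rw [norm_mul, mul_right_comm]
    exact mul_le_mul (hV.norm_le η hη) (hK η hη) (norm_nonneg _)
      (mul_nonneg hB (weight_nonneg hR _))

/-- One step of the iteration solving the integral equation for the Jost solution. -/
noncomputable def jostStep (V M : ℂ → ℂ) (η : ℂ) : ℂ :=
  1 + (rayIntegral 0 (fun z => V z * M z) η - rayIntegral 1 (fun z => V z * M z) η) /
    (2 * Complex.I)

/-- The terms −VM from the two ray integrals cancel. Hence the derivative is again a ray integral,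
and a second differentiation gives the equation for M. -/
theorem hasDerivAt_jostStep {R B : ℝ} (hR : 0 < R) (hB : 0 ≤ B) {V M : ℂ → ℂ}
    (hVM : DominatedOn R B (fun z => V z * M z)) {η : ℂ} (hη : η ∈ farRegion R) :
    HasDerivAt (jostStep V M) (-rayIntegral 1 (fun z => V z * M z) η) η := by
  have h0 := hasDerivAt_rayIntegral hR hB hVM hη 0
  have h1 := hasDerivAt_rayIntegral hR hB hVM hη 1
  refine (((h0.sub h1).div_const (2 * Complex.I)).const_add 1).congr_deriv ?_
  have : Complex.I ≠ 0 := Complex.I_ne_zero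
  field_simp
  push_cast
  ring

theorem norm_rayIntegral_sub_div_le {b : ℝ} {p q : ℂ} (hp : ‖p‖ ≤ b) (hq : ‖q‖ ≤ b) :
    ‖(p - q) / (2 * Complex.I)‖ ≤ b := by
  rw [norm_div, norm_mul, Complex.norm_I]
  have := norm_sub_le p q
  norm_num
  linarith

theorem norm_jostStep_sub_one_le {R B : ℝ} (hR : 0 < R) (hB : 0 ≤ B) {V M : ℂ → ℂ}
    (hVM : ∀ η ∈ farRegion R, ‖V η * M η‖ ≤ B * weight R η.re) {η : ℂ} (hη : η ∈ farRegion R) :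
    ‖jostStep V M η - 1‖ ≤ B * (10 * R ^ (-(1 / 5) : ℝ)) := by
  unfold jostStep
  rw [add_sub_cancel_left]
  exact norm_rayIntegral_sub_div_le (norm_rayIntegral_le hR hB hVM hη 0)
    (norm_rayIntegral_le hR hB hVM hη 1)

theorem norm_jostStep_sub_le {R B K d : ℝ} (hR : 0 < R) (hB : 0 ≤ B) (hd : 0 ≤ d) {V M M' : ℂ → ℂ}
    (hV : DominatedOn R B V)
    (hM : DifferentiableOn ℂ M (farRegion R)) (hK : ∀ η ∈ farRegion R, ‖M η‖ ≤ K)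
    (hM' : DifferentiableOn ℂ M' (farRegion R)) (hK' : ∀ η ∈ farRegion R, ‖M' η‖ ≤ K)
    (hsub : ∀ η ∈ farRegion R, ‖M η - M' η‖ ≤ d) {η : ℂ} (hη : η ∈ farRegion R) :
    ‖jostStep V M η - jostStep V M' η‖ ≤ B * (10 * R ^ (-(1 / 5) : ℝ)) * d := by
  have h1 := hV.mul hR hB hM hK
  have h2 := hV.mul hR hB hM' hK'
  have hs : ∀ η ∈ farRegion R, ‖V η * M η - V η * M' η‖ ≤ B * d * weight R η.re := by
    intro η hη
    rw [← mul_sub, norm_mul, mul_right_comm]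
    exact mul_le_mul (hV.norm_le η hη) (hsub η hη) (norm_nonneg _)
      (mul_nonneg hB (weight_nonneg hR _))
  have e : jostStep V M η - jostStep V M' η =
      (rayIntegral 0 (fun z => V z * M z - V z * M' z) η -
        rayIntegral 1 (fun z => V z * M z - V z * M' z) η) / (2 * Complex.I) := by
    rw [← rayIntegral_sub hR h1 h2 hη, ← rayIntegral_sub hR h1 h2 hη]
    unfold jostStep
    ring
  rw [e, mul_right_comm]
  have hBd : 0 ≤ B * d := mul_nonneg hB hd
  exact norm_rayIntegral_sub_div_le (norm_rayIntegral_le hR hBd hs hη 0)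
    (norm_rayIntegral_le hR hBd hs hη 1)

/-- The successive approximations of the Jost solution. -/
noncomputable def jostIter (V : ℂ → ℂ) : ℕ → ℂ → ℂ
  | 0 => fun _ => 1
  | n + 1 => jostStep V (jostIter V n)

section
variable {R B : ℝ} {V : ℂ → ℂ}

/-- The bound 2 reproduces itself: it makes VM at most 2B times the weight, and the smallness
assumption then gives a distance at most 1 from the constant 1. -/
theorem jostIter_spec (hR : 0 < R) (hB : 0 ≤ B) (hV : DominatedOn R B V)
    (hs : B * (10 * R ^ (-(1 / 5) : ℝ)) ≤ 1 / 2) (n : ℕ) :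
    DifferentiableOn ℂ (jostIter V n) (farRegion R) ∧ ∀ η ∈ farRegion R, ‖jostIter V n η‖ ≤ 2 := by
  induction n with
  | zero => exact ⟨differentiableOn_const _, fun η _ => by simp [jostIter]⟩
  | succ n ih =>
    have hVM := hV.mul hR hB ih.1 ih.2
    refine ⟨fun η hη => (hasDerivAt_jostStep hR (by positivity) hVM
      hη).differentiableAt.differentiableWithinAt, fun η hη => ?_⟩
    have h1 := norm_jostStep_sub_one_le hR (by positivity) hVM.norm_le hη
    have h2 : ‖jostStep V (jostIter V n) η‖ ≤ ‖jostStep V (jostIter V n) η - 1‖ + 1 := by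
      simpa using norm_add_le (jostStep V (jostIter V n) η - 1) 1
    change ‖jostStep V (jostIter V n) η‖ ≤ 2
    nlinarith

theorem norm_jostIter_succ_sub_le (hR : 0 < R) (hB : 0 ≤ B) (hV : DominatedOn R B V)
    (hs : B * (10 * R ^ (-(1 / 5) : ℝ)) ≤ 1 / 2) (n : ℕ) :
    ∀ η ∈ farRegion R, ‖jostIter V (n + 1) η - jostIter V n η‖ ≤ (1 / 2) ^ n := by
  induction n with
  | zero =>
    intro η hη
    have h0 := jostIter_spec hR hB hV hs 0
    have h1 := norm_jostStep_sub_one_le hR (by positivity) (hV.mul hR hB h0.1 h0.2).norm_le hη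
    change ‖jostStep V (jostIter V 0) η - 1‖ ≤ _
    rw [pow_zero]
    nlinarith
  | succ n ih =>
    intro η hη
    have h0 := jostIter_spec hR hB hV hs n
    have h1 := jostIter_spec hR hB hV hs (n + 1)
    have h := norm_jostStep_sub_le hR hB (by positivity) hV h1.1 h1.2 h0.1 h0.2 ih hη
    refine h.trans ?_
    rw [pow_succ']
    exact mul_le_mul_of_nonneg_right hs (by positivity)

/-- The Jost solution: `M'' - 2i M' = V M` with `M → 1` at infinity. -/
theorem exists_jost (hR : 0 < R) (hB : 0 ≤ B) (hV : DominatedOn R B V)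
    (hs : B * (10 * R ^ (-(1 / 5) : ℝ)) ≤ 1 / 2) :
    ∃ M N : ℂ → ℂ, (∀ η ∈ farRegion R, HasDerivAt M (N η) η) ∧
      (∀ η ∈ farRegion R, HasDerivAt N (2 * Complex.I * N η + V η * M η) η) ∧
      ∀ ρ B' : ℝ, R ≤ ρ → 0 ≤ B' → (∀ η ∈ farRegion ρ, ‖V η‖ ≤ B' * weight ρ η.re) →
        ∀ η ∈ farRegion ρ, ‖M η - 1‖ ≤ B' * 2 * (10 * ρ ^ (-(1 / 5) : ℝ)) ∧
          ‖N η‖ ≤ B' * 2 * (10 * ρ ^ (-(1 / 5) : ℝ)) := by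
  have hspec := jostIter_spec hR hB hV hs
  have hstep := norm_jostIter_succ_sub_le hR hB hV hs
  have hcauchy : ∀ η ∈ farRegion R, ∀ n, dist (jostIter V n η) (jostIter V (n + 1) η) ≤
      1 * (1 / 2) ^ n := by
    intro η hη n
    rw [dist_comm, dist_eq_norm, one_mul]
    exact hstep n η hη
  have hlim : ∀ η, ∃ m, η ∈ farRegion R → Tendsto (fun n => jostIter V n η) atTop (𝓝 m) := by
    intro η
    by_cases hη : η ∈ farRegion R
    · obtain ⟨m, hm⟩ := cauchySeq_tendsto_of_complete
        (cauchySeq_of_le_geometric (1 / 2) 1 (by norm_num) (hcauchy η hη))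
      exact ⟨m, fun _ => hm⟩
    · exact ⟨0, fun h => absurd h hη⟩
  choose M hM using hlim
  have hdist : ∀ n, ∀ η ∈ farRegion R, ‖jostIter V n η - M η‖ ≤ 2 * (1 / 2) ^ n := by
    intro n η hη
    have := dist_le_of_le_geometric_of_tendsto (1 / 2) 1 (by norm_num) (hcauchy η hη) (hM η hη) n
    rw [dist_eq_norm] at this
    refine this.trans (le_of_eq ?_)
    ring
  have hpow : Tendsto (fun n : ℕ => 2 * (1 / 2 : ℝ) ^ n) atTop (𝓝 0) := by
    simpa using (tendsto_pow_atTop_nhds_zero_of_lt_one (r := (1 / 2 : ℝ)) (by norm_num)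
      (by norm_num)).const_mul 2
  have hM2 : ∀ η ∈ farRegion R, ‖M η‖ ≤ 2 := fun η hη =>
    le_of_tendsto (hM η hη).norm (Eventually.of_forall fun n => (hspec n).2 η hη)
  have hMd : DifferentiableOn ℂ M (farRegion R) := by
    refine TendstoLocallyUniformlyOn.differentiableOn (φ := atTop) (F := jostIter V) ?_
      (Eventually.of_forall fun n => (hspec n).1) (isOpen_farRegion R)
    refine TendstoUniformlyOn.tendstoLocallyUniformlyOn ?_
    rw [Metric.tendstoUniformlyOn_iff]
    intro ε hε
    filter_upwards [hpow.eventually (gt_mem_nhds hε)] with n hn η hη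
    rw [dist_comm, dist_eq_norm]
    exact (hdist n η hη).trans_lt hn
  have hVM := hV.mul hR hB hMd hM2
  have hfix : ∀ η ∈ farRegion R, M η = jostStep V M η := by
    intro η hη
    refine tendsto_nhds_unique ((tendsto_add_atTop_iff_nat 1).2 (hM η hη)) ?_
    rw [tendsto_iff_norm_sub_tendsto_zero]
    refine squeeze_zero (fun _ => norm_nonneg _) (fun n => ?_) hpow
    refine (norm_jostStep_sub_le hR hB (by positivity) hV (hspec n).1 (hspec n).2 hMd hM2
      (hdist n) hη).trans ?_
    have : (0 : ℝ) ≤ 2 * (1 / 2) ^ n := by positivity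
    nlinarith
  have hB2 : 0 ≤ B * 2 := by positivity
  refine ⟨M, fun η => -rayIntegral 1 (fun z => V z * M z) η, fun η hη => ?_, fun η hη => ?_, ?_⟩
  · refine (hasDerivAt_jostStep hR hB2 hVM hη).congr_of_eventuallyEq ?_
    filter_upwards [(isOpen_farRegion R).mem_nhds hη] with z hz using hfix z hz
  · refine (hasDerivAt_rayIntegral hR hB2 hVM hη 1).neg.congr_deriv ?_
    push_cast
    ring
  -- Rays starting in `farRegion ρ` never leave it, so the fixed point equation can be estimated
  -- again with ρ in place of R. This turns boundedness into a rate of decay for the same M and N.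
  · intro ρ B' hρ hB' hV' η hη
    have hρ0 := hR.trans_le hρ
    have hVM' : ∀ z ∈ farRegion ρ, ‖V z * M z‖ ≤ B' * 2 * weight ρ z.re := by
      intro z hz
      rw [norm_mul, mul_right_comm]
      exact mul_le_mul (hV' z hz) (hM2 z (farRegion_anti hρ hz)) (norm_nonneg _)
        (mul_nonneg hB' (weight_nonneg hρ0 _))
    have hB'2 : 0 ≤ B' * 2 := by positivity
    constructor
    · rw [hfix η (farRegion_anti hρ hη)]
      exact norm_jostStep_sub_one_le hρ0 hB'2 hVM' hη
    · rw [norm_neg]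
      exact norm_rayIntegral_le hρ0 hB'2 hVM' hη 1

end

/-! ### Entire solutions by power series -/

/-- The power series with coefficients `a` has infinite radius of convergence. -/
def EntireCoeff (a : ℕ → ℂ) : Prop := ∀ ρ : ℝ, 0 < ρ → ∃ C, ∀ n, ‖a n‖ * ρ ^ n ≤ C

theorem EntireCoeff.summable {a : ℕ → ℂ} (ha : EntireCoeff a) {ρ : ℝ} (hρ : 0 < ρ) :
    Summable fun n => ‖a n‖ * ρ ^ n := by
  obtain ⟨C, hC⟩ := ha (2 * ρ) (by positivity)
  refine Summable.of_nonneg_of_le (fun n => by positivity) (fun n => ?_)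
    ((summable_geometric_of_lt_one (r := (1 / 2 : ℝ)) (by norm_num) (by norm_num)).mul_left C)
  have h := hC n
  rw [mul_pow] at h
  have h2 : (1 / 2 : ℝ) ^ n * 2 ^ n = 1 := by rw [← mul_pow]; norm_num
  calc ‖a n‖ * ρ ^ n = ‖a n‖ * ρ ^ n * ((1 / 2) ^ n * 2 ^ n) := by rw [h2, mul_one]
    _ = ‖a n‖ * (2 ^ n * ρ ^ n) * (1 / 2) ^ n := by ring
    _ ≤ C * (1 / 2) ^ n := mul_le_mul_of_nonneg_right h (by positivity)

theorem EntireCoeff.summable_mul_pow {a : ℕ → ℂ} (ha : EntireCoeff a) (z : ℂ) :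
    Summable fun n => a n * z ^ n := by
  refine Summable.of_norm_bounded (ha.summable (show 0 < ‖z‖ + 1 by positivity)) fun n => ?_
  rw [norm_mul, norm_pow]
  gcongr
  linarith

/-- The factor n + 1 ≤ 2^{n+1} is absorbed by doubling the radius. -/
theorem EntireCoeff.deriv {a : ℕ → ℂ} (ha : EntireCoeff a) :
    EntireCoeff fun n => (n + 1) * a (n + 1) := by
  intro ρ hρ
  obtain ⟨C, hC⟩ := ha (2 * ρ) (by positivity)
  refine ⟨C / ρ, fun n => ?_⟩
  have h := hC (n + 1)
  rw [mul_pow] at h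
  have h1 : ((n : ℝ) + 1) ≤ 2 ^ (n + 1) := by
    have := (Nat.lt_two_pow_self (n := n + 1)).le
    exact_mod_cast this
  have h2 : ‖((n : ℂ) + 1)‖ = (n : ℝ) + 1 := by
    have : ((n : ℂ) + 1) = ((n + 1 : ℕ) : ℂ) := by push_cast; rfl
    rw [this, Complex.norm_natCast]; push_cast; rfl
  rw [norm_mul, h2, le_div_iff₀ hρ]
  calc ((n : ℝ) + 1) * ‖a (n + 1)‖ * ρ ^ n * ρ = ‖a (n + 1)‖ * (((n : ℝ) + 1) * ρ ^ (n + 1)) := by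
        ring
    _ ≤ ‖a (n + 1)‖ * (2 ^ (n + 1) * ρ ^ (n + 1)) := by gcongr
    _ ≤ C := h

theorem EntireCoeff.hasDerivAt {a : ℕ → ℂ} (ha : EntireCoeff a) (z : ℂ) :
    HasDerivAt (fun z => ∑' n, a n * z ^ n) (∑' n, (n + 1) * a (n + 1) * z ^ n) z := by
  set ρ := ‖z‖ + 1 with hρ
  have hρ0 : 0 < ρ := by positivity
  have hs : Summable fun n : ℕ => ‖(n : ℂ) * a n‖ * ρ ^ (n - 1) := by
    rw [← summable_nat_add_iff 1]
    simpa using ha.deriv.summable hρ0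
  have h := hasDerivAt_tsum_of_isPreconnected (g := fun n z => a n * z ^ n)
    (g' := fun n z => a n * (n * z ^ (n - 1))) (t := Metric.ball (0 : ℂ) ρ) (y₀ := z) (y := z)
    hs Metric.isOpen_ball (convex_ball _ _).isPreconnected
    (fun n y _ => (hasDerivAt_pow n y).const_mul _)
    (fun n y hy => by
      have hy' : ‖y‖ ≤ ρ := by simpa using (Metric.mem_ball.1 hy).le
      rw [← mul_assoc, mul_comm (a n), norm_mul, norm_pow]
      gcongr)
    (by simp [hρ]) (ha.summable_mul_pow z) (by simp [hρ])
  refine h.congr_deriv ?_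
  have hs' : Summable fun n : ℕ => a n * (n * z ^ (n - 1)) := by
    rw [← summable_nat_add_iff 1]
    refine (ha.deriv.summable_mul_pow z).congr fun n => ?_
    rw [Nat.add_sub_cancel]
    push_cast
    ring
  rw [hs'.tsum_eq_zero_add]
  simp only [Nat.cast_zero, zero_mul, mul_zero, zero_add, Nat.add_sub_cancel]
  congr 1
  ext n
  push_cast
  ring

/-- Taylor coefficients of the solution of `F'' = (μ - y³) F` with `F(0) = a`, `F'(0) = b`. -/
noncomputable def cubicCoeff (μ a b : ℂ) : ℕ → ℂ
  | 0 => a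
  | 1 => b
  | 2 => μ * a / 2
  | 3 => μ * b / 6
  | 4 => μ * (μ * a / 2) / 12
  | n + 5 => (μ * cubicCoeff μ a b (n + 3) - cubicCoeff μ a b n) / ((n + 4) * (n + 5))

theorem entireCoeff_cubicCoeff (μ a b : ℂ) : EntireCoeff (cubicCoeff μ a b) := by
  intro ρ hρ
  -- Past this N the denominator (m + 4)(m + 5) of the recursion outweighs ‖μ‖ρ² + ρ⁵, so the sum of
  -- the first N + 5 terms bounds all later ones.
  obtain ⟨N, hN⟩ := exists_nat_ge (‖μ‖ * ρ ^ 2 + ρ ^ 5)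
  set c := cubicCoeff μ a b with hc
  set C := ∑ k ∈ Finset.range (N + 5), ‖c k‖ * ρ ^ k with hC
  have hC0 : 0 ≤ C := Finset.sum_nonneg fun k _ => by positivity
  refine ⟨C, fun n => ?_⟩
  induction n using Nat.strong_induction_on with
  | _ n ih =>
    by_cases hn : n < N + 5
    · exact Finset.single_le_sum (f := fun k => ‖c k‖ * ρ ^ k) (fun k _ => by positivity)
        (Finset.mem_range.2 hn)
    · obtain ⟨m, rfl⟩ : ∃ m, n = m + 5 := ⟨n - 5, by omega⟩
      have h3 := ih (m + 3) (by omega)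
      have h0 := ih m (by omega)
      have hm : (N : ℝ) ≤ m := by exact_mod_cast (by omega : N ≤ m)
      have e : c (m + 5) = (μ * c (m + 3) - c m) / ((m + 4) * (m + 5)) := by
        rw [hc, cubicCoeff]
      have hden : ‖((m : ℂ) + 4) * (m + 5)‖ = ((m : ℝ) + 4) * (m + 5) := by
        have : ((m : ℂ) + 4) * (m + 5) = (((m + 4) * (m + 5) : ℕ) : ℂ) := by push_cast; rfl
        rw [this, Complex.norm_natCast]; push_cast; rfl
      have hd0 : (0 : ℝ) < ((m : ℝ) + 4) * (m + 5) := by positivity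
      rw [e, norm_div, hden, div_mul_eq_mul_div, div_le_iff₀ hd0]
      calc ‖μ * c (m + 3) - c m‖ * ρ ^ (m + 5) ≤ (‖μ‖ * ‖c (m + 3)‖ + ‖c m‖) * ρ ^ (m + 5) := by
            gcongr
            exact (norm_sub_le _ _).trans (by rw [norm_mul])
        _ = ‖μ‖ * ρ ^ 2 * (‖c (m + 3)‖ * ρ ^ (m + 3)) + ρ ^ 5 * (‖c m‖ * ρ ^ m) := by ring
        _ ≤ ‖μ‖ * ρ ^ 2 * C + ρ ^ 5 * C := by gcongr
        _ = C * (‖μ‖ * ρ ^ 2 + ρ ^ 5) := by ring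
        _ ≤ C * (((m : ℝ) + 4) * (m + 5)) := by
            gcongr
            have h0m : (0 : ℝ) ≤ m := by positivity
            nlinarith

/-- Supplies the entire solutions with initial data (1, 0) and (0, 1), against which a solution
known only far out is expanded. -/
theorem exists_entire_solution (μ a b : ℂ) :
    ∃ F G : ℂ → ℂ, (∀ y, HasDerivAt F (G y) y) ∧ (∀ y, HasDerivAt G ((μ - y ^ 3) * F y) y) ∧
      F 0 = a ∧ G 0 = b := by
  set c := cubicCoeff μ a b with hc
  have h := entireCoeff_cubicCoeff μ a b
  have h1 := h.deriv
  have h2 := h1.deriv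
  refine ⟨_, _, h.hasDerivAt, fun y => (h1.hasDerivAt y).congr_deriv ?_, ?_, ?_⟩
  · have hs := h.summable_mul_pow y
    -- The term y³F contributes only from degree 3 on; the first three coefficients are compared
    -- separately.
    rw [← h2.summable_mul_pow y |>.sum_add_tsum_nat_add 3]
    have e1 : ∀ n : ℕ, ((n + 3 : ℕ) + 1 : ℂ) * (((n + 3 + 1 : ℕ) + 1) * c (n + 3 + 1 + 1)) *
        y ^ (n + 3) = μ * (c (n + 3) * y ^ (n + 3)) - y ^ 3 * (c n * y ^ n) := by
      intro n
      have : c (n + 5) = (μ * c (n + 3) - c n) / ((n + 4) * (n + 5)) := by rw [hc, cubicCoeff]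
      rw [this]
      have h4 : (n : ℂ) + 4 ≠ 0 := by exact_mod_cast (by omega : n + 4 ≠ 0)
      have h5 : (n : ℂ) + 5 ≠ 0 := by exact_mod_cast (by omega : n + 5 ≠ 0)
      push_cast
      field_simp
      ring
    rw [tsum_congr e1, Summable.tsum_sub (((summable_nat_add_iff 3).2 hs).mul_left μ)
      (hs.mul_left _), tsum_mul_left, tsum_mul_left, sub_mul, ← hs.sum_add_tsum_nat_add 3]
    simp only [Finset.sum_range_succ, Finset.sum_range_zero, cubicCoeff]
    push_cast
    ring
  · rw [tsum_eq_single 0 (by intro n hn; simp [hn])]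
    simp [cubicCoeff]
  · rw [tsum_eq_single 0 (by intro n hn; simp [hn])]
    simp [cubicCoeff]

/-! ### The Liouville-Green variable and the recessive solution -/

/-- `(5η/2)^{1/10}`, so that `y = t⁴` and `η = (2/5) y^{5/2}`. -/
noncomputable def tenthRoot (η : ℂ) : ℂ := Complex.exp (Complex.log (5 / 2 * η) / 10)

theorem tenthRoot_ne_zero (η : ℂ) : tenthRoot η ≠ 0 := Complex.exp_ne_zero _

theorem mul_mem_slitPlane {η : ℂ} (h : η ∈ Complex.slitPlane) :
    5 / 2 * η ∈ Complex.slitPlane := by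
  have e : (5 / 2 : ℂ) = ((5 / 2 : ℝ) : ℂ) := by push_cast; rfl
  rw [Complex.mem_slitPlane_iff] at h ⊢
  rw [e, Complex.re_ofReal_mul, Complex.im_ofReal_mul]
  exact h.imp (fun h => by positivity) fun h => by positivity

theorem tenthRoot_pow_ten {η : ℂ} (h : η ≠ 0) : tenthRoot η ^ 10 = 5 / 2 * η := by
  unfold tenthRoot
  rw [← Complex.exp_nat_mul]
  push_cast
  rw [mul_div_cancel₀ _ (by norm_num), Complex.exp_log (by simp [h])]

theorem norm_tenthRoot {η : ℂ} (h : η ≠ 0) :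
    ‖tenthRoot η‖ = (5 / 2 * ‖η‖) ^ (1 / 10 : ℝ) := by
  have h1 : ‖tenthRoot η‖ ^ 10 = 5 / 2 * ‖η‖ := by
    rw [← norm_pow, tenthRoot_pow_ten h, norm_mul]; norm_num
  rw [← h1, ← Real.rpow_natCast, ← Real.rpow_mul (norm_nonneg _)]
  norm_num

/-- Differentiate t¹⁰ = 5η/2. With t as the only radical, y^{3/4} = t³ and y^{3/2} = t⁶, so the
differential equations below become rational identities in t. -/
theorem hasDerivAt_tenthRoot {η : ℂ} (h : η ∈ Complex.slitPlane) :
    HasDerivAt tenthRoot (1 / (4 * tenthRoot η ^ 9)) η := by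
  have h0 : η ≠ 0 := Complex.slitPlane_ne_zero h
  have h1 := ((((hasDerivAt_id η).const_mul (5 / 2 : ℂ)).clog (mul_mem_slitPlane h)).div_const
    10).cexp
  refine h1.congr_deriv ?_
  have ht := tenthRoot_ne_zero η
  have h10 := tenthRoot_pow_ten h0
  change tenthRoot η * (5 / 2 * 1 / (5 / 2 * η) / 10) = _
  rw [← h10]
  field_simp
  norm_num

/-- The potential of the equation in the variable `η`. -/
noncomputable def jostPotential (μ η : ℂ) : ℂ :=
  (μ - 21 / 16 / tenthRoot η ^ 8) / tenthRoot η ^ 12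

theorem one_le_norm_tenthRoot {ρ : ℝ} (hρ : 1 ≤ ρ) {η : ℂ} (h : η ∈ farRegion ρ) :
    1 ≤ ‖tenthRoot η‖ := by
  have h1 := norm_ge_of_mem_farRegion h
  have h2 := abs_nonneg η.re
  rw [norm_tenthRoot (Complex.slitPlane_ne_zero
    (mem_slitPlane_of_mem_farRegion (by linarith) h))]
  exact Real.one_le_rpow (by linarith) (by norm_num)

/-- Here |t|^{-12} = (5|η|/2)^{-6/5}, and |η| ≥ (ρ + |Re η|)/2 in the far region, with 5/4 ≥ 1 to
spare. Since |t| ≥ 1, the remaining factor is at most ‖μ‖ + 21/16. -/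
theorem norm_jostPotential_le {ρ : ℝ} (hρ : 1 ≤ ρ) (μ : ℂ) {η : ℂ} (h : η ∈ farRegion ρ) :
    ‖jostPotential μ η‖ ≤ (‖μ‖ + 2) * weight ρ η.re := by
  have h0 : η ≠ 0 := Complex.slitPlane_ne_zero (mem_slitPlane_of_mem_farRegion (by linarith) h)
  have h1 := norm_ge_of_mem_farRegion h
  have h2 := abs_nonneg η.re
  have ht := one_le_norm_tenthRoot hρ h
  have e : (‖tenthRoot η‖ ^ 12)⁻¹ ≤ weight ρ η.re := by
    rw [norm_tenthRoot h0, ← Real.rpow_natCast, ← Real.rpow_mul (by positivity),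
      ← Real.rpow_neg (by positivity)]
    unfold weight
    have : -(1 / 10 * ((12 : ℕ) : ℝ)) = -(6 / 5 : ℝ) := by norm_num
    rw [this]
    exact Real.rpow_le_rpow_of_nonpos (by linarith) (by linarith) (by norm_num)
  unfold jostPotential
  rw [norm_div, norm_pow, div_eq_mul_inv]
  refine mul_le_mul ?_ e (by positivity) (by positivity)
  refine (norm_sub_le _ _).trans ?_
  gcongr
  rw [norm_div, norm_pow]
  have h8 : (1 : ℝ) ≤ ‖tenthRoot η‖ ^ 8 := one_le_pow₀ ht
  rw [div_le_iff₀ (by positivity)]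
  norm_num
  linarith

/-- Beyond this radius the successive approximations for the parameter `μ` converge. -/
noncomputable def jostRadius (μ : ℂ) : ℝ := (20 * (‖μ‖ + 2)) ^ 5

theorem one_le_jostRadius (μ : ℂ) : 1 ≤ jostRadius μ :=
  one_le_pow₀ (by linarith [norm_nonneg μ])

theorem dominatedOn_jostPotential (μ : ℂ) :
    DominatedOn (jostRadius μ) (‖μ‖ + 2) (jostPotential μ) where
  differentiableOn η hη := by
    have ht := (hasDerivAt_tenthRoot (mem_slitPlane_of_mem_farRegion
      (zero_le_one.trans (one_le_jostRadius μ)) hη)).differentiableAt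
    have h0 := tenthRoot_ne_zero η
    refine DifferentiableAt.differentiableWithinAt ?_
    unfold jostPotential
    exact DifferentiableAt.div (DifferentiableAt.const_sub (DifferentiableAt.div
      (by fun_prop) (ht.pow 8) (pow_ne_zero _ h0)) _) (ht.pow 12) (pow_ne_zero _ h0)
  norm_le _ hη := norm_jostPotential_le (one_le_jostRadius μ) μ hη

/-- `F` is an entire solution of `F'' = (μ - y³) F` with `F' = G`, which far out has the form
`y^{-3/4} e^{-iη} M(η)` with `η = (2/5) y^{5/2}`, where `M → 1` and `N = M' → 0`. -/
structure IsJostSolution (μ : ℂ) (F G M N : ℂ → ℂ) : Prop where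
  hasDerivAt : ∀ y, HasDerivAt F (G y) y
  hasDerivAt' : ∀ y, HasDerivAt G ((μ - y ^ 3) * F y) y
  eq : ∀ η ∈ farRegion (jostRadius μ), F (tenthRoot η ^ 4) =
    Complex.exp (-(Complex.I * η)) * M η / tenthRoot η ^ 3
  eq' : ∀ η ∈ farRegion (jostRadius μ), G (tenthRoot η ^ 4) =
    Complex.exp (-(Complex.I * η)) *
      ((-(3 / 4) / tenthRoot η ^ 4 - Complex.I * tenthRoot η ^ 6) * M η +
        tenthRoot η ^ 6 * N η) / tenthRoot η ^ 3
  norm_le : ∀ ρ, jostRadius μ ≤ ρ → ∀ η ∈ farRegion ρ,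
    ‖M η - 1‖ ≤ (‖μ‖ + 2) * 2 * (10 * ρ ^ (-(1 / 5) : ℝ))
  norm_le' : ∀ ρ, jostRadius μ ≤ ρ → ∀ η ∈ farRegion ρ,
    ‖N η‖ ≤ (‖μ‖ + 2) * 2 * (10 * ρ ^ (-(1 / 5) : ℝ))

theorem wronskian_const {q F G F' G' : ℂ → ℂ} (hF : ∀ y, HasDerivAt F (G y) y)
    (hG : ∀ y, HasDerivAt G (q y * F y) y) (hF' : ∀ y, HasDerivAt F' (G' y) y)
    (hG' : ∀ y, HasDerivAt G' (q y * F' y) y) (x y : ℂ) :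
    F x * G' x - G x * F' x = F y * G' y - G y * F' y := by
  have h : ∀ y, HasDerivAt (fun y => F y * G' y - G y * F' y) 0 y := fun y =>
    (((hF y).mul (hG' y)).sub ((hG y).mul (hF' y))).congr_deriv (by ring)
  exact is_const_of_deriv_eq_zero (fun y => (h y).differentiableAt) (fun y => (h y).deriv) x y

/-- The function built from M lives only on part of the slit η-plane. Its Wronskians a, b with the
entire solutions χ, φ are constant there, and aφ − bχ is an entire function that agrees with it
because φ and χ have Wronskian 1. -/
theorem exists_isJostSolution (μ : ℂ) : ∃ F G M N, IsJostSolution μ F G M N := by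
  set R := jostRadius μ with hRdef
  have hR1 : 1 ≤ R := one_le_jostRadius μ
  have hR : 0 < R := by linarith
  have hB : 0 ≤ ‖μ‖ + 2 := by positivity
  -- The fifth power in `jostRadius` is chosen for this identity, which makes the contraction factor
  -- exactly 1/2.
  have hRpow : R ^ (-(1 / 5) : ℝ) = (20 * (‖μ‖ + 2))⁻¹ := by
    rw [hRdef, jostRadius, ← Real.rpow_natCast, ← Real.rpow_mul (by positivity),
      ← Real.rpow_neg_one]
    norm_num
  have hsmall : (‖μ‖ + 2) * (10 * R ^ (-(1 / 5) : ℝ)) ≤ 1 / 2 := by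
    rw [hRpow]
    field_simp
    norm_num
  obtain ⟨M, N, hM, hN, hbound⟩ := exists_jost hR hB (dominatedOn_jostPotential μ) hsmall
  set u : ℂ → ℂ := fun η => Complex.exp (-(Complex.I * η)) * M η / tenthRoot η ^ 3 with hu
  -- This is the derivative of u with respect to y; since dη/dy = t⁶, the η-derivative of u is v/t⁶.
  set v : ℂ → ℂ := fun η => Complex.exp (-(Complex.I * η)) *
      ((-(3 / 4) / tenthRoot η ^ 4 - Complex.I * tenthRoot η ^ 6) * M η +
        tenthRoot η ^ 6 * N η) / tenthRoot η ^ 3 with hv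
  have hslit : ∀ η ∈ farRegion R, η ∈ Complex.slitPlane := fun η hη =>
    mem_slitPlane_of_mem_farRegion hR.le hη
  have hexp : ∀ η : ℂ, HasDerivAt (fun η => Complex.exp (-(Complex.I * η)))
      (Complex.exp (-(Complex.I * η)) * -Complex.I) η := fun η => by
    simpa using ((hasDerivAt_id η).const_mul Complex.I).neg.cexp
  have hdu : ∀ η ∈ farRegion R, HasDerivAt u (v η / tenthRoot η ^ 6) η := by
    intro η hη
    have ht := hasDerivAt_tenthRoot (hslit η hη)
    have h0 := tenthRoot_ne_zero η
    refine (((hexp η).mul (hM η hη)).div (ht.pow 3) (pow_ne_zero _ h0)).congr_deriv ?_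
    simp only [hv, Pi.mul_apply, Pi.pow_apply]
    generalize tenthRoot η = t at *
    field_simp
    ring
  have hdv : ∀ η ∈ farRegion R,
      HasDerivAt v ((μ - tenthRoot η ^ 12) * u η / tenthRoot η ^ 6) η := by
    intro η hη
    have ht := hasDerivAt_tenthRoot (hslit η hη)
    have h0 := tenthRoot_ne_zero η
    refine (((hexp η).mul (((((hasDerivAt_const η (-(3 / 4) : ℂ)).div (ht.pow 4)
      (pow_ne_zero _ h0)).sub ((ht.pow 6).const_mul Complex.I)).mul (hM η hη)).add
      ((ht.pow 6).mul (hN η hη)))).div (ht.pow 3) (pow_ne_zero _ h0)).congr_deriv ?_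
    simp only [hu, Pi.mul_apply, Pi.pow_apply, Pi.add_apply, Pi.sub_apply, Pi.div_apply,
      jostPotential]
    generalize tenthRoot η = t at *
    have hI := Complex.I_sq
    field_simp
    ring_nf
    simp only [hI]
    ring
  have hdy : ∀ η ∈ farRegion R,
      HasDerivAt (fun η => tenthRoot η ^ 4) (1 / tenthRoot η ^ 6) η := by
    intro η hη
    have h0 := tenthRoot_ne_zero η
    refine ((hasDerivAt_tenthRoot (hslit η hη)).pow 4).congr_deriv ?_
    field_simp
    norm_num
  have hconst : ∀ φ φ' : ℂ → ℂ, (∀ y, HasDerivAt φ (φ' y) y) →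
      (∀ y, HasDerivAt φ' ((μ - y ^ 3) * φ y) y) → ∃ a, ∀ η ∈ farRegion R,
        u η * φ' (tenthRoot η ^ 4) - v η * φ (tenthRoot η ^ 4) = a := by
    intro φ φ' h h'
    have hd : ∀ η ∈ farRegion R, HasDerivAt (fun η => u η * φ' (tenthRoot η ^ 4) -
        v η * φ (tenthRoot η ^ 4)) 0 η := by
      intro η hη
      have h0 := tenthRoot_ne_zero η
      refine (((hdu η hη).mul ((h' _).comp η (hdy η hη))).sub
        ((hdv η hη).mul ((h _).comp η (hdy η hη)))).congr_deriv ?_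
      simp only [Function.comp_apply]
      field_simp
      ring
    exact (isOpen_farRegion R).exists_is_const_of_deriv_eq_zero (isPreconnected_farRegion R)
      (fun η hη => (hd η hη).differentiableAt.differentiableWithinAt)
      (fun η hη => (hd η hη).deriv)
  obtain ⟨φ, φ', hφ, hφ', hφ0, hφ'0⟩ := exists_entire_solution μ 1 0
  obtain ⟨χ, χ', hχ, hχ', hχ0, hχ'0⟩ := exists_entire_solution μ 0 1
  obtain ⟨a, ha⟩ := hconst χ χ' hχ hχ'
  obtain ⟨b, hb⟩ := hconst φ φ' hφ hφ'
  have hW : ∀ y, φ y * χ' y - φ' y * χ y = 1 := by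
    intro y
    rw [wronskian_const hφ hφ' hχ hχ' y 0, hφ0, hφ'0, hχ0, hχ'0]
    ring
  refine ⟨fun y => a * φ y - b * χ y, fun y => a * φ' y - b * χ' y, M, N,
    fun y => ((hφ y).const_mul a).sub ((hχ y).const_mul b),
    fun y => (((hφ' y).const_mul a).sub ((hχ' y).const_mul b)).congr_deriv (by ring),
    fun η hη => ?_, fun η hη => ?_, fun ρ hρ η hη => ?_, fun ρ hρ η hη => ?_⟩
  · change _ = u η
    simp only [← ha η hη, ← hb η hη]
    linear_combination u η * hW (tenthRoot η ^ 4)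
  · change _ = v η
    simp only [← ha η hη, ← hb η hη]
    linear_combination v η * hW (tenthRoot η ^ 4)
  · exact (hbound ρ _ hρ hB
      (fun z hz => norm_jostPotential_le (hR1.trans hρ) μ hz) η hη).1
  · exact (hbound ρ _ hρ hB
      (fun z hz => norm_jostPotential_le (hR1.trans hρ) μ hz) η hη).2

/-! ### The solution recessive on the positive axis -/

theorem alpha_ne_zero : alpha ≠ 0 := Complex.exp_ne_zero _

theorem omega_eq : omega = alpha ^ 4 := by
  unfold omega alpha
  rw [← Complex.exp_nat_mul]
  congr 1
  push_cast
  ring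

theorem alpha_pow_five : alpha ^ 5 = Complex.I := by
  unfold alpha
  rw [← Complex.exp_nat_mul]
  refine Eq.trans ?_ Complex.exp_pi_div_two_mul_I
  congr 1
  push_cast
  ring

theorem alpha_pow_ten : alpha ^ 10 = -1 := by
  rw [show alpha ^ 10 = (alpha ^ 5) ^ 2 by ring, alpha_pow_five, Complex.I_sq]

theorem norm_alpha : ‖alpha‖ = 1 := by
  unfold alpha
  rw [Complex.norm_exp]
  simp

theorem norm_omega : ‖omega‖ = 1 := by rw [omega_eq, norm_pow, norm_alpha, one_pow]

theorem omega_ne_zero : omega ≠ 0 := Complex.exp_ne_zero _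

theorem conj_alpha : conj alpha = alpha⁻¹ := by
  rw [Complex.inv_def, Complex.normSq_eq_norm_sq, norm_alpha]
  simp

theorem conj_omega : conj omega = omega⁻¹ := by
  rw [omega_eq, map_pow, conj_alpha, inv_pow]

/-- The function `F` of a chosen Jost solution. -/
noncomputable def jostF (μ : ℂ) : ℂ → ℂ := (exists_isJostSolution μ).choose

/-- The derivative of `jostF`. -/
noncomputable def jostG (μ : ℂ) : ℂ → ℂ := (exists_isJostSolution μ).choose_spec.choose

/-- The modulating factor of `jostF`. -/
noncomputable def jostM (μ : ℂ) : ℂ → ℂ := (exists_isJostSolution μ).choose_spec.choose_spec.choose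

/-- The derivative of the modulating factor of `jostF`. -/
noncomputable def jostN (μ : ℂ) : ℂ → ℂ :=
  (exists_isJostSolution μ).choose_spec.choose_spec.choose_spec.choose

theorem isJostSolution (μ : ℂ) : IsJostSolution μ (jostF μ) (jostG μ) (jostM μ) (jostN μ) :=
  (exists_isJostSolution μ).choose_spec.choose_spec.choose_spec.choose_spec

/-- `u` is an entire solution of `u'' = (z³ + lam) u` with derivative `u'`. -/
structure IsSol (lam : ℂ) (u u' : ℂ → ℂ) : Prop where
  hasDerivAt : ∀ z, HasDerivAt u (u' z) z
  hasDerivAt' : ∀ z, HasDerivAt u' ((z ^ 3 + lam) * u z) z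

/-- The constant `e^{-3πi/20}`. -/
noncomputable def kappa : ℂ := Complex.exp (-(3 * Real.pi * Complex.I / 20))

theorem kappa_mul_conj : kappa * conj kappa = 1 := by
  rw [Complex.mul_conj, Complex.normSq_eq_norm_sq]
  unfold kappa
  rw [Complex.norm_exp]
  simp

/-- The recessive solution, with asymptotics known in the upper part of the sector. -/
noncomputable def upper (z lam : ℂ) : ℂ := kappa * jostF (omega * lam) ((alpha ^ 2)⁻¹ * z)

/-- The derivative of `upper`. -/
noncomputable def upper' (z lam : ℂ) : ℂ :=
  kappa * (alpha ^ 2)⁻¹ * jostG (omega * lam) ((alpha ^ 2)⁻¹ * z)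

/-- Two derivatives produce α⁻⁴ = ω⁻¹, which cancels the ω in ωλ, and α¹⁰ = −1 changes −y³ into z³.
-/
theorem isSol_rotate (lam c : ℂ) {F G : ℂ → ℂ} (hF : ∀ y, HasDerivAt F (G y) y)
    (hG : ∀ y, HasDerivAt G ((omega * lam - y ^ 3) * F y) y) :
    IsSol lam (fun z => c * F ((alpha ^ 2)⁻¹ * z))
      (fun z => c * (alpha ^ 2)⁻¹ * G ((alpha ^ 2)⁻¹ * z)) := by
  have hl : ∀ z, HasDerivAt (fun z => (alpha ^ 2)⁻¹ * z) (alpha ^ 2)⁻¹ z := fun z => by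
    simpa using (hasDerivAt_id z).const_mul (alpha ^ 2)⁻¹
  refine ⟨fun z => (((hF _).comp z (hl z)).const_mul _).congr_deriv (by ring),
    fun z => (((hG _).comp z (hl z)).const_mul _).congr_deriv ?_⟩
  have h0 := alpha_ne_zero
  have h10 := alpha_pow_ten
  rw [omega_eq]
  field_simp
  linear_combination (c * F (z / alpha ^ 2) * z ^ 3) * (-h10)

theorem isSol_upper (lam : ℂ) : IsSol lam (fun z => upper z lam) (fun z => upper' z lam) :=
  isSol_rotate lam kappa (isJostSolution _).hasDerivAt (isJostSolution _).hasDerivAt'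

/-- `η = (2/5) (e^{-iπ/5} z)^{5/2}`. -/
noncomputable def etaVar (z : ℂ) : ℂ :=
  2 / 5 * Complex.exp (5 / 2 * (Complex.log z - Real.pi / 5 * Complex.I))

theorem norm_leadingTerm {z : ℂ} (hz : z ≠ 0) : ‖leadingTerm z‖ =
    ‖z‖ ^ (-(3 / 4) : ℝ) * Real.exp (-(2 / 5) * (‖z‖ ^ (5 / 2 : ℝ) * Real.cos (5 / 2 * z.arg))) := by
  have e : ∀ c : ℝ, z ^ (c : ℂ) = (‖z‖ ^ c : ℝ) * Complex.exp (((c * z.arg : ℝ) : ℂ) * Complex.I) := by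
    intro c
    rw [Complex.cpow_def_of_ne_zero hz, Complex.log,
      Real.rpow_def_of_pos (norm_pos_iff.2 hz), Complex.ofReal_exp, ← Complex.exp_add]
    congr 1
    push_cast
    ring
  unfold leadingTerm
  have e1 := e (-(3 / 4))
  have e2 := e (5 / 2)
  push_cast at e1 e2
  rw [norm_mul, Complex.norm_exp, e1, e2, norm_mul]
  congr 1
  · rw [Complex.norm_real, Real.norm_of_nonneg (by positivity), Complex.norm_exp]
    simp
  · congr 1
    have h3 : Complex.exp (5 / 2 * (z.arg : ℂ) * Complex.I) =
        Complex.exp (((5 / 2 * z.arg : ℝ) : ℂ) * Complex.I) := by push_cast; rfl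
    have h4 : (-(2 / 5) : ℂ) = ((-(2 / 5) : ℝ) : ℂ) := by push_cast; rfl
    rw [h3, h4, Complex.re_ofReal_mul, Complex.re_ofReal_mul, Complex.exp_ofReal_mul_I_re]

theorem leadingTerm_ne_zero {z : ℂ} (hz : z ≠ 0) : leadingTerm z ≠ 0 :=
  mul_ne_zero ((Complex.cpow_ne_zero_iff).2 (Or.inl hz)) (Complex.exp_ne_zero _)

section
variable {z : ℂ}

theorem etaVar_eq (hz : z ≠ 0) : etaVar z = ((2 / 5 * ‖z‖ ^ (5 / 2 : ℝ) : ℝ) : ℂ) *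
    Complex.exp (((5 / 2 * (z.arg - Real.pi / 5) : ℝ) : ℂ) * Complex.I) := by
  unfold etaVar
  rw [Complex.log, Real.rpow_def_of_pos (norm_pos_iff.2 hz), Complex.ofReal_mul,
    Complex.ofReal_exp, mul_assoc, ← Complex.exp_add]
  push_cast
  congr 2
  ring

/-- The bounds on arg z say precisely that (5/2)(arg z − π/5) lies in (−π, π], so that the principal
logarithm undoes the exponential. -/
theorem tenthRoot_etaVar (h1 : -(Real.pi / 5) < z.arg) (h2 : z.arg ≤ 3 * Real.pi / 5) :
    tenthRoot (etaVar z) = Complex.exp ((Complex.log z - Real.pi / 5 * Complex.I) / 4) := by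
  have him : (5 / 2 * (Complex.log z - Real.pi / 5 * Complex.I)).im =
      5 / 2 * (z.arg - Real.pi / 5) := by
    have : (5 / 2 * (Complex.log z - Real.pi / 5 * Complex.I)) =
      ((5 / 2 : ℝ) : ℂ) * (Complex.log z - ((Real.pi / 5 : ℝ) : ℂ) * Complex.I) := by
      push_cast; rfl
    rw [this, Complex.im_ofReal_mul, Complex.sub_im, Complex.im_ofReal_mul, Complex.log_im]
    simp
  unfold tenthRoot etaVar
  rw [← mul_assoc, show (5 / 2 * (2 / 5) : ℂ) = 1 by norm_num, one_mul, Complex.log_exp]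
  · congr 1
    ring
  · rw [him]; linarith
  · rw [him]; linarith

theorem tenthRoot_etaVar_pow_four (hz : z ≠ 0) (h1 : -(Real.pi / 5) < z.arg)
    (h2 : z.arg ≤ 3 * Real.pi / 5) : tenthRoot (etaVar z) ^ 4 = (alpha ^ 2)⁻¹ * z := by
  rw [tenthRoot_etaVar h1 h2, ← Complex.exp_nat_mul]
  unfold alpha
  rw [← Complex.exp_nat_mul, ← Complex.exp_neg]
  nth_rewrite 2 [← Complex.exp_log hz]
  rw [← Complex.exp_add]
  congr 1
  push_cast
  ring

/-- The factor `kappa` compensates (e^{-iπ/5})^{-3/4}, and (e^{-iπ/5})^{5/2} = −i turns the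
oscillating exponent −iη into −(2/5)z^{5/2}. -/
theorem kappa_mul_eq_leadingTerm (hz : z ≠ 0) (h1 : -(Real.pi / 5) < z.arg)
    (h2 : z.arg ≤ 3 * Real.pi / 5) :
    kappa * (Complex.exp (-(Complex.I * etaVar z)) / tenthRoot (etaVar z) ^ 3) =
      leadingTerm z := by
  have e1 : kappa / tenthRoot (etaVar z) ^ 3 = z ^ (-(3 / 4) : ℂ) := by
    rw [tenthRoot_etaVar h1 h2, ← Complex.exp_nat_mul, Complex.cpow_def_of_ne_zero hz, kappa,
      ← Complex.exp_sub]
    congr 1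
    push_cast
    ring
  have e2 : -(Complex.I * etaVar z) = -(2 / 5) * z ^ (5 / 2 : ℂ) := by
    have h3 : Complex.exp (5 / 2 * (Complex.log z - Real.pi / 5 * Complex.I)) =
        Complex.exp (Complex.log z * (5 / 2)) * -Complex.I := by
      rw [← Complex.exp_neg_pi_div_two_mul_I, ← Complex.exp_add]
      congr 1
      ring
    rw [etaVar, Complex.cpow_def_of_ne_zero hz, h3]
    linear_combination (2 / 5 * Complex.exp (Complex.log z * (5 / 2))) * Complex.I_sq
  rw [leadingTerm, ← e1, ← e2]
  ring

theorem norm_tenthRoot_etaVar (hz : z ≠ 0) : ‖tenthRoot (etaVar z)‖ = ‖z‖ ^ (1 / 4 : ℝ) := by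
  have hn : ‖etaVar z‖ = 2 / 5 * ‖z‖ ^ (5 / 2 : ℝ) := by
    rw [etaVar_eq hz, norm_mul, Complex.norm_exp_ofReal_mul_I, Complex.norm_real, mul_one,
      Real.norm_of_nonneg (by positivity)]
  have h0 : etaVar z ≠ 0 := mul_ne_zero (by norm_num) (Complex.exp_ne_zero _)
  rw [norm_tenthRoot h0, hn, ← mul_assoc, show (5 / 2 * (2 / 5) : ℝ) = 1 by norm_num, one_mul,
    ← Real.rpow_mul (norm_nonneg _)]
  norm_num

theorem upper_eq {lam : ℂ} (hz : z ≠ 0) (h1 : -(Real.pi / 5) < z.arg)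
    (h2 : z.arg ≤ 3 * Real.pi / 5) (hfar : etaVar z ∈ farRegion (jostRadius (omega * lam))) :
    upper z lam = leadingTerm z * jostM (omega * lam) (etaVar z) := by
  have h := (isJostSolution (omega * lam)).eq _ hfar
  rw [tenthRoot_etaVar_pow_four hz h1 h2] at h
  rw [upper, h, ← kappa_mul_eq_leadingTerm hz h1 h2]
  ring

theorem upper'_eq {lam : ℂ} (hz : z ≠ 0) (h1 : -(Real.pi / 5) < z.arg)
    (h2 : z.arg ≤ 3 * Real.pi / 5) (hfar : etaVar z ∈ farRegion (jostRadius (omega * lam))) :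
    upper' z lam = leadingTerm z * (alpha ^ 2)⁻¹ *
      ((-(3 / 4) / tenthRoot (etaVar z) ^ 4 - Complex.I * tenthRoot (etaVar z) ^ 6) *
        jostM (omega * lam) (etaVar z) +
        tenthRoot (etaVar z) ^ 6 * jostN (omega * lam) (etaVar z)) := by
  have h := (isJostSolution (omega * lam)).eq' _ hfar
  rw [tenthRoot_etaVar_pow_four hz h1 h2] at h
  rw [upper', h, ← kappa_mul_eq_leadingTerm hz h1 h2, ← tenthRoot_etaVar_pow_four hz h1 h2]
  ring

theorem etaVar_mem_farRegion (hz : z ≠ 0) {k ρ : ℝ}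
    (hk : k ≤ max (Real.cos (5 / 2 * (z.arg - Real.pi / 5)))
      |Real.sin (5 / 2 * (z.arg - Real.pi / 5))|)
    (hρ : ρ < 2 / 5 * ‖z‖ ^ (5 / 2 : ℝ) * k) : etaVar z ∈ farRegion ρ := by
  have hp : 0 ≤ 2 / 5 * ‖z‖ ^ (5 / 2 : ℝ) := by positivity
  change ρ < max (etaVar z).re |(etaVar z).im|
  rw [etaVar_eq hz, Complex.re_ofReal_mul, Complex.im_ofReal_mul, Complex.exp_ofReal_mul_I_re,
    Complex.exp_ofReal_mul_I_im, abs_mul, abs_of_nonneg hp, ← mul_max_of_nonneg _ _ hp]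
  exact hρ.trans_le (mul_le_mul_of_nonneg_left hk hp)

end

/-- The angle runs through a compact interval from −π/2 to π − 5ε/2, where the sine vanishes only at
0 and the cosine is 1 there. The margin ε excludes the angle π, the direction of the cut. -/
theorem exists_le_max_cos_sin {ε : ℝ} (hε : 0 < ε) : ∃ k : ℝ, 0 < k ∧
    ∀ θ : ℝ, 0 ≤ θ → θ ≤ 3 * Real.pi / 5 - ε →
      k ≤ max (Real.cos (5 / 2 * (θ - Real.pi / 5))) |Real.sin (5 / 2 * (θ - Real.pi / 5))| := by
  set g : ℝ → ℝ := fun θ =>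
    max (Real.cos (5 / 2 * (θ - Real.pi / 5))) |Real.sin (5 / 2 * (θ - Real.pi / 5))| with hg
  have hc : Continuous g := by fun_prop
  have hpos : ∀ θ ∈ Icc (0 : ℝ) (3 * Real.pi / 5 - ε), 0 < g θ := by
    intro θ hθ
    rw [hg, lt_max_iff]
    have hpi := Real.pi_pos
    by_cases hs : Real.sin (5 / 2 * (θ - Real.pi / 5)) = 0
    · left
      rw [Real.sin_eq_zero_iff_of_lt_of_lt (by linarith [hθ.1]) (by linarith [hθ.2])] at hs
      rw [hs, Real.cos_zero]
      norm_num
    · right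
      exact abs_pos.2 hs
  rcases (Icc (0 : ℝ) (3 * Real.pi / 5 - ε)).eq_empty_or_nonempty with he | hne
  · refine ⟨1, one_pos, fun θ h1 h2 => ?_⟩
    have : θ ∈ Icc (0 : ℝ) (3 * Real.pi / 5 - ε) := ⟨h1, h2⟩
    rw [he] at this
    exact absurd this (notMem_empty _)
  · obtain ⟨θ₀, hθ₀, hmin⟩ := isCompact_Icc.exists_isMinOn hne hc.continuousOn
    exact ⟨g θ₀, hpos θ₀ hθ₀, fun θ h1 h2 => hmin ⟨h1, h2⟩⟩

theorem jostRadius_le {lam : ℂ} {b : ℝ} (h : ‖lam‖ ≤ b) :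
    jostRadius (omega * lam) ≤ (20 * (b + 2)) ^ 5 := by
  unfold jostRadius
  rw [norm_mul, norm_omega, one_mul]
  gcongr

/-- The point η lies in `farRegion ρ` with ρ a fixed multiple of |z|^{5/2}, so ρ^{-1/5} is a
multiple of |z|^{-1/2}. The constants depend on λ only through b, which gives uniformity on compact
sets. Half of the available multiple is used, because the far region is defined by a strict
inequality. -/
theorem upper_asymptotics {ε : ℝ} (hε : 0 < ε) (b : ℝ) : ∃ C R : ℝ, 1 ≤ R ∧
    ∀ lam : ℂ, ‖lam‖ ≤ b → ∀ z : ℂ, R ≤ ‖z‖ → 0 ≤ z.arg → z.arg ≤ 3 * Real.pi / 5 - ε →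
      ‖jostM (omega * lam) (etaVar z) - 1‖ ≤ C * ‖z‖ ^ (-(1 / 2) : ℝ) ∧
      ‖jostN (omega * lam) (etaVar z)‖ ≤ C * ‖z‖ ^ (-(1 / 2) : ℝ) ∧
      etaVar z ∈ farRegion (jostRadius (omega * lam)) := by
  obtain ⟨k, hk0, hk⟩ := exists_le_max_cos_sin hε
  set J := (20 * (b + 2)) ^ 5 with hJ
  refine ⟨(b + 2) * 2 * (10 * (k / 5) ^ (-(1 / 5) : ℝ)), max 1 (5 * J / k), le_max_left _ _,
    fun lam hlam z hz h1 h2 => ?_⟩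
  have hz1 : 1 ≤ ‖z‖ := (le_max_left _ _).trans hz
  have hz2 : 5 * J / k ≤ ‖z‖ := (le_max_right _ _).trans hz
  have hz0 : z ≠ 0 := norm_pos_iff.1 (by linarith)
  have hpow : ‖z‖ ≤ ‖z‖ ^ (5 / 2 : ℝ) := by
    nth_rewrite 1 [← Real.rpow_one ‖z‖]
    exact Real.rpow_le_rpow_of_exponent_le hz1 (by norm_num)
  have hb : 0 ≤ b := (norm_nonneg _).trans hlam
  set ρ := k / 5 * ‖z‖ ^ (5 / 2 : ℝ) with hρ
  have hρJ : jostRadius (omega * lam) ≤ ρ := by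
    refine (jostRadius_le hlam).trans ?_
    rw [div_le_iff₀ hk0] at hz2
    rw [hρ]
    nlinarith
  have hmem : etaVar z ∈ farRegion ρ := by
    refine etaVar_mem_farRegion hz0 (hk _ h1 h2) ?_
    have : 0 < k * ‖z‖ ^ (5 / 2 : ℝ) := by positivity
    rw [hρ]
    linarith
  have hρpow : ρ ^ (-(1 / 5) : ℝ) = (k / 5) ^ (-(1 / 5) : ℝ) * ‖z‖ ^ (-(1 / 2) : ℝ) := by
    rw [hρ, Real.mul_rpow (by positivity) (by positivity), ← Real.rpow_mul (norm_nonneg _)]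
    norm_num
  have hle : (‖omega * lam‖ + 2) * 2 * (10 * ρ ^ (-(1 / 5) : ℝ)) ≤
      (b + 2) * 2 * (10 * (k / 5) ^ (-(1 / 5) : ℝ)) * ‖z‖ ^ (-(1 / 2) : ℝ) := by
    rw [hρpow, norm_mul, norm_omega, one_mul, mul_assoc _ (10 * _), mul_assoc 10]
    gcongr
  have hS := isJostSolution (omega * lam)
  exact ⟨(hS.norm_le ρ hρJ _ hmem).trans hle, (hS.norm_le' ρ hρJ _ hmem).trans hle,
    farRegion_anti hρJ hmem⟩

theorem upper_decay (lam : ℂ) : ∃ R : ℝ, 0 < R ∧ ∀ z : ℂ, R ≤ ‖z‖ → 0 ≤ z.arg →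
    z.arg ≤ Real.pi / 10 → ‖upper z lam‖ ≤ 10 * Real.exp (-‖z‖) ∧
      ‖upper' z lam‖ ≤ 10 * Real.exp (-‖z‖) := by
  have hpi := Real.pi_pos
  -- The choice ε = π/2 leaves exactly the sector 0 ≤ arg z ≤ π/10. There cos((5/2) arg z) ≥ 1/2, so
  -- |z| ≥ 10 yields e^{-2|z|} for the leading term; half of that rate absorbs the powers of |z| in
  -- the derivative.
  obtain ⟨C, R, hR1, h⟩ := upper_asymptotics (ε := Real.pi / 2) (by positivity) ‖lam‖
  obtain ⟨R', hR'⟩ : ∃ R', ∀ r, R' ≤ r → C * r ^ (-(1 / 2) : ℝ) ≤ 1 := by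
    have : Tendsto (fun r : ℝ => C * r ^ (-(1 / 2) : ℝ)) atTop (𝓝 (C * 0)) :=
      (tendsto_rpow_neg_atTop (by norm_num)).const_mul C
    rw [mul_zero] at this
    exact eventually_atTop.1 (this.eventually_le_const one_pos)
  refine ⟨max (max R R') 10, by positivity, fun z hz h1 h2 => ?_⟩
  have hzR : R ≤ ‖z‖ := ((le_max_left _ _).trans (le_max_left _ _)).trans hz
  have hzR' : R' ≤ ‖z‖ := ((le_max_right _ _).trans (le_max_left _ _)).trans hz
  have hz10 : 10 ≤ ‖z‖ := (le_max_right _ _).trans hz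
  have hz0 : z ≠ 0 := norm_pos_iff.1 (by linarith)
  obtain ⟨hM, hN, hfar⟩ := h lam le_rfl z hzR h1 (by linarith)
  have hs := hR' _ hzR'
  have hM2 : ‖jostM (omega * lam) (etaVar z)‖ ≤ 2 := by
    have := norm_add_le (jostM (omega * lam) (etaVar z) - 1) 1
    rw [sub_add_cancel, norm_one] at this
    linarith
  have hN1 := hN.trans hs
  set r := ‖z‖ with hr
  have hr0 : 0 < r := by linarith
  set X := r ^ (3 / 2 : ℝ) with hX
  have hXr : r ≤ X := by
    nth_rewrite 1 [← Real.rpow_one r]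
    exact Real.rpow_le_rpow_of_exponent_le (by linarith) (by norm_num)
  have hX2 : X ≤ r ^ 2 := by
    rw [← Real.rpow_natCast]
    exact Real.rpow_le_rpow_of_exponent_le (by linarith) (by norm_num)
  have hX52 : r ^ (5 / 2 : ℝ) = r * X := by
    rw [hX]
    nth_rewrite 2 [← Real.rpow_one r]
    rw [← Real.rpow_add hr0]
    norm_num
  have hcos : 1 / 2 ≤ Real.cos (5 / 2 * z.arg) := by
    rw [← Real.cos_pi_div_three]
    exact Real.cos_le_cos_of_nonneg_of_le_pi (by linarith) (by linarith) (by linarith)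
  have hlead : ‖leadingTerm z‖ ≤ Real.exp (-(2 * r)) := by
    rw [norm_leadingTerm hz0, ← hr, hX52]
    have h3 : r ^ (-(3 / 4) : ℝ) ≤ 1 :=
      Real.rpow_le_one_of_one_le_of_nonpos (by linarith) (by norm_num)
    have h4 : Real.exp (-(2 / 5) * (r * X * Real.cos (5 / 2 * z.arg))) ≤ Real.exp (-(2 * r)) := by
      apply Real.exp_le_exp.2
      have h5 : r * 10 ≤ r * X := by gcongr; linarith
      nlinarith
    calc _ ≤ 1 * Real.exp (-(2 * r)) := by gcongr
      _ = _ := one_mul _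
  have hexp : r ^ 2 * Real.exp (-(2 * r)) ≤ 2 * Real.exp (-r) := by
    have h6 := Real.quadratic_le_exp_of_nonneg hr0.le
    have h7 : Real.exp (-(2 * r)) = Real.exp (-r) * Real.exp (-r) := by
      rw [← Real.exp_add]; ring_nf
    have h8 : Real.exp r * Real.exp (-r) = 1 := by rw [← Real.exp_add]; simp
    have h9 := Real.exp_pos (-r)
    rw [h7, ← mul_assoc]
    refine mul_le_mul_of_nonneg_right ?_ h9.le
    nlinarith
  have ht : ‖tenthRoot (etaVar z)‖ ^ 6 = X := by
    rw [norm_tenthRoot_etaVar hz0, ← hr, ← Real.rpow_natCast, ← Real.rpow_mul hr0.le]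
    norm_num [hX]
  have ht4 : ‖tenthRoot (etaVar z)‖ ^ 4 = r := by
    rw [norm_tenthRoot_etaVar hz0, ← hr, ← Real.rpow_natCast, ← Real.rpow_mul hr0.le]
    norm_num
  have hexp0 := Real.exp_pos (-(2 * r))
  constructor
  · rw [upper_eq hz0 (by linarith) (by linarith) hfar, norm_mul]
    calc _ ≤ Real.exp (-(2 * r)) * 2 := by gcongr
      _ ≤ _ := by nlinarith
  · rw [upper'_eq hz0 (by linarith) (by linarith) hfar, norm_mul, norm_mul, norm_inv, norm_pow,
      norm_alpha, one_pow, inv_one, mul_one]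
    have hb : ‖((-(3 / 4) / tenthRoot (etaVar z) ^ 4 - Complex.I * tenthRoot (etaVar z) ^ 6) *
        jostM (omega * lam) (etaVar z) +
        tenthRoot (etaVar z) ^ 6 * jostN (omega * lam) (etaVar z))‖ ≤ 5 * r ^ 2 := by
      refine (norm_add_le _ _).trans ?_
      rw [norm_mul, norm_mul, norm_pow, ht]
      have h10 : ‖-(3 / 4) / tenthRoot (etaVar z) ^ 4 - Complex.I * tenthRoot (etaVar z) ^ 6‖ ≤
          1 + X := by
        refine (norm_sub_le _ _).trans ?_
        rw [norm_div, norm_pow, ht4, norm_mul, norm_pow, ht, Complex.norm_I, one_mul]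
        gcongr
        rw [div_le_one hr0]
        norm_num
        linarith
      calc _ ≤ (1 + X) * 2 + X * 1 := by gcongr
        _ ≤ _ := by nlinarith
    calc _ ≤ Real.exp (-(2 * r)) * (5 * r ^ 2) := by gcongr
      _ ≤ _ := by linarith

/-! ### Wronskians and bases of solutions -/

theorem hasDerivAt_conj_conj_comp {F G : ℂ → ℂ} (h : ∀ y, HasDerivAt F (G y) y) (y : ℂ) :
    HasDerivAt (fun y => conj (F (conj y))) (conj (G (conj y))) y := by
  have := (h (conj y)).conj_conj
  rwa [Complex.conj_conj] at this

theorem hasDerivAt_conj_jostG (μ y : ℂ) :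
    HasDerivAt (fun y => conj (jostG (conj μ) (conj y)))
      ((μ - y ^ 3) * conj (jostF (conj μ) (conj y))) y := by
  refine (hasDerivAt_conj_conj_comp (isJostSolution (conj μ)).hasDerivAt' y).congr_deriv ?_
  simp

theorem jostRadius_conj (μ : ℂ) : jostRadius (conj μ) = jostRadius μ := by
  simp [jostRadius]

theorem conj_tenthRoot {x : ℝ} (hx : 0 < x) : conj (tenthRoot x) = tenthRoot x := by
  have h : (5 / 2 * x : ℂ) = ((5 / 2 * x : ℝ) : ℂ) := by push_cast; rfl
  rw [tenthRoot, h, ← Complex.ofReal_log (by positivity), ← Complex.exp_conj, map_div₀,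
    Complex.conj_ofReal, Complex.conj_ofNat]

/-- Being constant, the Wronskian may be evaluated along η → +∞, where both asymptotic forms hold.
The exponentials and the powers of t cancel and 2i·M·M̄ + o(1) remains. -/
theorem jost_wronskian (μ y : ℂ) :
    jostF μ y * conj (jostG (conj μ) (conj y)) - jostG μ y * conj (jostF (conj μ) (conj y)) =
      2 * Complex.I := by
  have hS := isJostSolution μ
  have hS' := isJostSolution (conj μ)
  set J := jostRadius μ with hJ
  have hJ1 : 1 ≤ J := one_le_jostRadius μ
  have hform : ∀ x : ℝ, J < x →
      jostF μ y * conj (jostG (conj μ) (conj y)) - jostG μ y * conj (jostF (conj μ) (conj y)) =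
      2 * Complex.I * (jostM μ x * conj (jostM (conj μ) x)) +
        (jostM μ x * conj (jostN (conj μ) x) - jostN μ x * conj (jostM (conj μ) x)) := by
    intro x hx
    have hmem : (x : ℂ) ∈ farRegion J := lt_max_iff.2 (Or.inl (by simpa using hx))
    have ht := conj_tenthRoot (show 0 < x by linarith)
    have h0 := tenthRoot_ne_zero x
    have hmem' : (x : ℂ) ∈ farRegion (jostRadius (conj μ)) := by rwa [jostRadius_conj]
    have e1 : conj (tenthRoot x ^ 4) = tenthRoot x ^ 4 := by rw [map_pow, ht]
    rw [wronskian_const hS.hasDerivAt hS.hasDerivAt'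
      (hasDerivAt_conj_conj_comp hS'.hasDerivAt) (hasDerivAt_conj_jostG μ) y (tenthRoot x ^ 4),
      e1, hS.eq _ hmem, hS.eq' _ hmem, hS'.eq _ hmem', hS'.eq' _ hmem']
    have hexp : conj (Complex.exp (-(Complex.I * x))) = Complex.exp (Complex.I * x) := by
      rw [← Complex.exp_conj]; simp
    have hee : Complex.exp (-(Complex.I * x)) * Complex.exp (Complex.I * x) = 1 := by
      rw [← Complex.exp_add]; simp
    have h34 : conj (3 / 4 : ℂ) = 3 / 4 := by
      rw [map_div₀, Complex.conj_ofNat, Complex.conj_ofNat]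
    simp only [map_div₀, map_mul, map_add, map_sub, map_neg, map_pow, ht, hexp, h34,
      Complex.conj_I]
    generalize tenthRoot x = t at *
    generalize Complex.exp (-(Complex.I * x)) = e at *
    generalize Complex.exp (Complex.I * x) = e' at *
    field_simp
    linear_combination (8 * Complex.I * t ^ 10 * jostM μ x * conj (jostM (conj μ) x) +
      4 * t ^ 10 * (jostM μ x * conj (jostN (conj μ) x) - jostN μ x * conj (jostM (conj μ) x))) * hee
  have hlim0 : Tendsto (fun x : ℝ => (‖μ‖ + 2) * 2 * (10 * (x / 2) ^ (-(1 / 5) : ℝ)))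
      atTop (𝓝 0) := by
    have h1 : Tendsto (fun x : ℝ => (x / 2) ^ (-(1 / 5) : ℝ)) atTop (𝓝 0) :=
      (tendsto_rpow_neg_atTop (by norm_num)).comp (tendsto_id.atTop_div_const (by norm_num))
    simpa using (h1.const_mul 10).const_mul ((‖μ‖ + 2) * 2)
  -- The point x belongs to `farRegion (x / 2)`, so the bounds with ρ = x/2 tend to zero as x → ∞.
  have hmem2 : ∀ x : ℝ, 2 * J < x → J ≤ x / 2 ∧ (x : ℂ) ∈ farRegion (x / 2) := fun x hx =>
    ⟨by linarith, lt_max_of_lt_left (show x / 2 < (x : ℂ).re by rw [Complex.ofReal_re]; linarith)⟩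
  have hM : Tendsto (fun x : ℝ => jostM μ x) atTop (𝓝 1) := by
    rw [tendsto_iff_norm_sub_tendsto_zero]
    refine squeeze_zero' (Eventually.of_forall fun _ => norm_nonneg _) ?_ hlim0
    filter_upwards [eventually_gt_atTop (2 * J)] with x hx
    exact hS.norm_le _ (hmem2 x hx).1 _ (hmem2 x hx).2
  have hN : Tendsto (fun x : ℝ => jostN μ x) atTop (𝓝 0) := by
    rw [tendsto_zero_iff_norm_tendsto_zero]
    refine squeeze_zero' (Eventually.of_forall fun _ => norm_nonneg _) ?_ hlim0
    filter_upwards [eventually_gt_atTop (2 * J)] with x hx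
    exact hS.norm_le' _ (hmem2 x hx).1 _ (hmem2 x hx).2
  have hM' : Tendsto (fun x : ℝ => conj (jostM (conj μ) x)) atTop (𝓝 1) := by
    rw [tendsto_iff_norm_sub_tendsto_zero]
    refine squeeze_zero' (Eventually.of_forall fun _ => norm_nonneg _) ?_ hlim0
    filter_upwards [eventually_gt_atTop (2 * J)] with x hx
    have := hS'.norm_le (x / 2) (by rw [jostRadius_conj]; exact (hmem2 x hx).1) _ (hmem2 x hx).2
    rw [RCLike.norm_conj] at this
    rw [← RCLike.norm_conj]
    simpa using this
  have hN' : Tendsto (fun x : ℝ => conj (jostN (conj μ) x)) atTop (𝓝 0) := by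
    rw [tendsto_zero_iff_norm_tendsto_zero]
    refine squeeze_zero' (Eventually.of_forall fun _ => norm_nonneg _) ?_ hlim0
    filter_upwards [eventually_gt_atTop (2 * J)] with x hx
    have := hS'.norm_le' (x / 2) (by rw [jostRadius_conj]; exact (hmem2 x hx).1) _ (hmem2 x hx).2
    rw [RCLike.norm_conj] at this ⊢
    exact this
  have hlim := (((hM.mul hM').const_mul (2 * Complex.I))).add ((hM.mul hN').sub (hN.mul hM'))
  refine tendsto_nhds_unique (tendsto_const_nhds.congr' ?_)
    (hlim.trans (by simp))
  filter_upwards [eventually_gt_atTop J] with x hx using hform x hx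

/-- The solution proportional to `f₊`, independent of `upper`. -/
noncomputable def growing (z lam : ℂ) : ℂ :=
  conj kappa * conj (jostF (conj (omega * lam)) (conj ((alpha ^ 2)⁻¹ * z)))

/-- The derivative of `growing`. -/
noncomputable def growing' (z lam : ℂ) : ℂ :=
  conj kappa * (alpha ^ 2)⁻¹ * conj (jostG (conj (omega * lam)) (conj ((alpha ^ 2)⁻¹ * z)))

theorem isSol_growing (lam : ℂ) : IsSol lam (fun z => growing z lam) (fun z => growing' z lam) :=
  isSol_rotate lam (conj kappa) (hasDerivAt_conj_conj_comp (isJostSolution _).hasDerivAt)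
    (hasDerivAt_conj_jostG _)

theorem upper_growing_wronskian (z lam : ℂ) :
    upper z lam * growing' z lam - upper' z lam * growing z lam =
      2 * Complex.I * (alpha ^ 2)⁻¹ := by
  have h := jost_wronskian (omega * lam) ((alpha ^ 2)⁻¹ * z)
  have hk := kappa_mul_conj
  unfold upper upper' growing growing'
  linear_combination (kappa * conj kappa * (alpha ^ 2)⁻¹) * h +
    (2 * Complex.I * (alpha ^ 2)⁻¹) * hk

theorem upper_growing_wronskian_ne_zero : 2 * Complex.I * (alpha ^ 2)⁻¹ ≠ 0 :=
  mul_ne_zero (mul_ne_zero two_ne_zero Complex.I_ne_zero)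
    (inv_ne_zero (pow_ne_zero _ alpha_ne_zero))

namespace IsSol

variable {lam : ℂ} {u u' v v' : ℂ → ℂ}

theorem wronskian (hu : IsSol lam u u') (hv : IsSol lam v v') (x y : ℂ) :
    u x * v' x - u' x * v x = u y * v' y - u' y * v y :=
  wronskian_const (q := fun z => z ^ 3 + lam) hu.hasDerivAt hu.hasDerivAt' hv.hasDerivAt
    hv.hasDerivAt' x y

theorem add (hu : IsSol lam u u') (hv : IsSol lam v v') :
    IsSol lam (fun z => u z + v z) (fun z => u' z + v' z) :=
  ⟨fun z => (hu.hasDerivAt z).add (hv.hasDerivAt z),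
    fun z => ((hu.hasDerivAt' z).add (hv.hasDerivAt' z)).congr_deriv (by ring)⟩

theorem const_mul (hu : IsSol lam u u') (c : ℂ) :
    IsSol lam (fun z => c * u z) (fun z => c * u' z) :=
  ⟨fun z => (hu.hasDerivAt z).const_mul c,
    fun z => ((hu.hasDerivAt' z).const_mul c).congr_deriv (by ring)⟩

theorem conj_conj (hu : IsSol lam u u') :
    IsSol (conj lam) (fun z => conj (u (conj z))) (fun z => conj (u' (conj z))) :=
  ⟨hasDerivAt_conj_conj_comp hu.hasDerivAt, fun z =>
    (hasDerivAt_conj_conj_comp hu.hasDerivAt' z).congr_deriv (by simp)⟩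

/-- Cramer's rule in the basis `upper`, `growing`: the coordinates are Wronskians, hence can be
computed at any base point z₀. -/
theorem mul_wronskian_eq (hu : IsSol lam u u') (z₀ z : ℂ) :
    u z * (2 * Complex.I * (alpha ^ 2)⁻¹) =
      (u z₀ * growing' z₀ lam - u' z₀ * growing z₀ lam) * upper z lam -
      (u z₀ * upper' z₀ lam - u' z₀ * upper z₀ lam) * growing z lam := by
  rw [hu.wronskian (isSol_growing lam) z₀ z, hu.wronskian (isSol_upper lam) z₀ z,
    ← upper_growing_wronskian z lam]
  ring

theorem exists_eq_add (hu : IsSol lam u u') :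
    ∃ a b : ℂ, ∀ z, u z = a * upper z lam + b * growing z lam := by
  have h0 := upper_growing_wronskian_ne_zero
  refine ⟨(u 0 * growing' 0 lam - u' 0 * growing 0 lam) / (2 * Complex.I * (alpha ^ 2)⁻¹),
    -(u 0 * upper' 0 lam - u' 0 * upper 0 lam) / (2 * Complex.I * (alpha ^ 2)⁻¹), fun z => ?_⟩
  have h := hu.mul_wronskian_eq 0 z
  rw [div_mul_eq_mul_div, div_mul_eq_mul_div, ← add_div, eq_div_iff h0, h]
  ring

theorem eq_zero (hu : IsSol lam u u') {z₀ : ℂ} (h : u z₀ = 0) (h' : u' z₀ = 0) (z : ℂ) :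
    u z = 0 := by
  have := hu.mul_wronskian_eq z₀ z
  rw [h, h'] at this
  simp only [zero_mul, sub_zero] at this
  exact (mul_eq_zero.1 this).resolve_right upper_growing_wronskian_ne_zero

/-- Subtract from v the multiple of u that agrees with it at z₀. The vanishing Wronskian makes the
derivatives agree there too, and `eq_zero` applies. -/
theorem exists_eq_const_mul (hu : IsSol lam u u') (hv : IsSol lam v v') {x z₀ : ℂ}
    (hW : u x * v' x - u' x * v x = 0) (h0 : u z₀ ≠ 0) : ∃ c : ℂ, ∀ z, v z = c * u z := by
  rw [hu.wronskian hv x z₀] at hW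
  refine ⟨v z₀ / u z₀, fun z => ?_⟩
  have h := (hv.add (hu.const_mul (-(v z₀ / u z₀)))).eq_zero (z₀ := z₀)
    (by field_simp; ring) (by field_simp; linear_combination hW) z
  linear_combination h

end IsSol

theorem exists_upper_ne_zero (lam : ℂ) : ∃ z, upper z lam ≠ 0 := by
  by_contra! h
  have h' : ∀ z, upper' z lam = 0 := fun z => by
    have h1 := (isSol_upper lam).hasDerivAt z
    have h2 : (fun z => upper z lam) = fun _ => 0 := funext h
    rw [h2] at h1
    exact h1.unique (hasDerivAt_const z 0)
  refine upper_growing_wronskian_ne_zero ?_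
  rw [← upper_growing_wronskian 0 lam, h, h']
  ring

/-! ### Uniqueness of the subdominant solution -/

theorem omega_pow_five : omega ^ 5 = 1 := by
  rw [omega_eq, ← pow_mul, show 4 * 5 = 10 * 2 by norm_num, pow_mul, alpha_pow_ten]
  norm_num

/-- Without the conjugations this would be f₊, but the conjugation symmetry of f is not yet
available. For z > 0 the rotated argument has angle 2π/5, inside the half sector where asymptotics
are known. -/
theorem growing_eq (z lam : ℂ) :
    growing z lam = conj (upper (conj (omega⁻¹ * z)) (conj ((omega ^ 3)⁻¹ * lam))) := by
  have h5 := omega_pow_five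
  have h0 := omega_ne_zero
  have ha := alpha_ne_zero
  have e1 : conj (omega * lam) = omega * conj ((omega ^ 3)⁻¹ * lam) := by
    simp only [map_mul, map_inv₀, map_pow, conj_omega]
    field_simp
    linear_combination -conj lam * h5
  have e2 : conj ((alpha ^ 2)⁻¹ * z) = (alpha ^ 2)⁻¹ * conj (omega⁻¹ * z) := by
    simp only [map_mul, map_inv₀, map_pow, conj_alpha, omega_eq]
    field_simp
  rw [growing, upper, e1, e2]
  exact (map_mul _ _ _).symm

theorem tendsto_rpow_bound (C : ℝ) :
    Tendsto (fun r : ℝ => C * r ^ (-(1 / 2) : ℝ)) atTop (𝓝 0) := by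
  have : Tendsto (fun r : ℝ => C * r ^ (-(1 / 2) : ℝ)) atTop (𝓝 (C * 0)) :=
    (tendsto_rpow_neg_atTop (by norm_num)).const_mul C
  rwa [mul_zero] at this

theorem upper_div_leadingTerm_tendsto (lam : ℂ) {θ : ℂ} (hθ : ‖θ‖ = 1) (h1 : 0 ≤ θ.arg)
    (h2 : θ.arg ≤ 2 * Real.pi / 5) :
    Tendsto (fun r : ℝ => upper (θ * r) lam / leadingTerm (θ * r)) atTop (𝓝 1) := by
  have hpi := Real.pi_pos
  obtain ⟨C, R, hR, h⟩ := upper_asymptotics (ε := Real.pi / 5) (by positivity) ‖lam‖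
  rw [tendsto_iff_norm_sub_tendsto_zero]
  refine squeeze_zero' (Eventually.of_forall fun _ => norm_nonneg _) ?_ (tendsto_rpow_bound C)
  filter_upwards [eventually_ge_atTop R] with r hr
  have hr0 : 0 < r := by linarith
  have hn : ‖θ * r‖ = r := by
    rw [norm_mul, hθ, one_mul, Complex.norm_real, Real.norm_of_nonneg hr0.le]
  have harg : (θ * r).arg = θ.arg := Complex.arg_mul_real hr0 θ
  have hz : θ * r ≠ 0 := norm_pos_iff.1 (by rw [hn]; exact hr0)
  obtain ⟨hM, -, hfar⟩ := h lam le_rfl (θ * r) (by rwa [hn]) (by rwa [harg])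
    (by rw [harg]; linarith)
  rw [upper_eq hz (by rw [harg]; linarith) (by rw [harg]; linarith) hfar,
    mul_div_cancel_left₀ _ (leadingTerm_ne_zero hz)]
  rwa [hn] at hM

theorem arg_omega : omega.arg = 2 * Real.pi / 5 := by
  have hpi := Real.pi_pos
  have e : 2 * Real.pi * Complex.I / 5 = ((2 * Real.pi / 5 : ℝ) : ℂ) * Complex.I := by
    push_cast; ring
  rw [← Complex.log_im, omega, e, Complex.log_exp]
  · simp
  · rw [Complex.im_ofReal_mul, Complex.I_im]; linarith
  · rw [Complex.im_ofReal_mul, Complex.I_im]; linarith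

/-- At angle 2π/5 the exponent has cos π = −1 in place of 1, so the quotient grows like
e^{(4/5)r^{5/2}}. -/
theorem growing_div_leadingTerm_tendsto (lam : ℂ) :
    Tendsto (fun r : ℝ => ‖growing r lam / leadingTerm r‖) atTop atTop := by
  have hpi := Real.pi_pos
  have h1 := upper_div_leadingTerm_tendsto (conj ((omega ^ 3)⁻¹ * lam)) norm_omega
    (by rw [arg_omega]; positivity) arg_omega.le
  have h2 : Tendsto (fun r : ℝ => Real.exp (4 / 5 * r ^ (5 / 2 : ℝ))) atTop atTop :=
    Real.tendsto_exp_atTop.comp ((tendsto_rpow_atTop (by norm_num)).const_mul_atTop (by norm_num))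
  refine (h1.norm.pos_mul_atTop (by simp) h2).congr' ?_
  filter_upwards [eventually_gt_atTop 0] with r hr
  have hr' : (r : ℂ) ≠ 0 := by exact_mod_cast hr.ne'
  have hz : omega * r ≠ 0 := mul_ne_zero omega_ne_zero hr'
  have e1 : conj (omega⁻¹ * r) = omega * r := by
    simp [conj_omega]
  have harg : (omega * r).arg = 2 * Real.pi / 5 := by
    rw [Complex.arg_mul_real hr, arg_omega]
  have hn : ‖omega * r‖ = r := by
    rw [norm_mul, norm_omega, one_mul, Complex.norm_real, Real.norm_of_nonneg hr.le]
  rw [growing_eq, e1, norm_div, norm_div, RCLike.norm_conj, norm_leadingTerm hz,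
    norm_leadingTerm hr', hn, harg, Complex.arg_ofReal_of_nonneg hr.le, Complex.norm_real,
    Real.norm_of_nonneg hr.le, show 5 / 2 * (2 * Real.pi / 5) = Real.pi by ring, Real.cos_pi,
    mul_zero, Real.cos_zero]
  have hE : Real.exp (-(2 / 5) * (r ^ (5 / 2 : ℝ) * -1)) =
      Real.exp (-(2 / 5) * (r ^ (5 / 2 : ℝ) * 1)) * Real.exp (4 / 5 * r ^ (5 / 2 : ℝ)) := by
    rw [← Real.exp_add]
    ring_nf
  rw [hE]
  have hp : 0 < r ^ (-(3 / 4) : ℝ) := by positivity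
  have he1 := Real.exp_pos (-(2 / 5) * (r ^ (5 / 2 : ℝ) * 1))
  have he2 := Real.exp_pos (4 / 5 * r ^ (5 / 2 : ℝ))
  field_simp

/-- Write u = a·f + b·g with g the growing solution. Divided by the leading term, g is unbounded on
the positive axis, so b = 0; the limit 1 then gives a = 1. -/
theorem IsSol.eq_upper {lam : ℂ} {u u' : ℂ → ℂ} (hu : IsSol lam u u')
    (h : Tendsto (fun r : ℝ => u r / leadingTerm r) atTop (𝓝 1)) (z : ℂ) :
    u z = upper z lam := by
  obtain ⟨a, b, hab⟩ := hu.exists_eq_add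
  have hU : Tendsto (fun r : ℝ => upper r lam / leadingTerm r) atTop (𝓝 1) := by
    have := upper_div_leadingTerm_tendsto lam (θ := 1) (by simp) (by simp)
      (by simp; positivity)
    simpa using this
  have hsub := h.sub (hU.const_mul a)
  have e : ∀ r : ℝ, u r / leadingTerm r - a * (upper r lam / leadingTerm r) =
      b * (growing r lam / leadingTerm r) := fun r => by
    rw [hab r]; ring
  simp only [e] at hsub
  have hb : b = 0 := by
    by_contra hb
    have h1 := (growing_div_leadingTerm_tendsto lam).const_mul_atTop (norm_pos_iff.2 hb)
    refine not_tendsto_nhds_of_tendsto_atTop h1 ‖1 - a * 1‖ ?_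
    simpa only [norm_mul] using hsub.norm
  have ha : 1 = a := by
    simp only [hb, zero_mul] at hsub
    have := tendsto_nhds_unique hsub tendsto_const_nhds
    linear_combination this
  rw [hab, hb, ← ha]
  ring

theorem conj_leadingTerm {z : ℂ} (hz : z.arg ≠ Real.pi) :
    conj (leadingTerm z) = leadingTerm (conj z) := by
  have e : ∀ c : ℝ, conj (z ^ (c : ℂ)) = conj z ^ (c : ℂ) := fun c => by
    rw [Complex.conj_cpow _ _ hz, Complex.conj_ofReal]
  have e1 := e (-(3 / 4))
  have e2 := e (5 / 2)
  push_cast at e1 e2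
  unfold leadingTerm
  rw [map_mul, e1, ← Complex.exp_conj, map_mul, e2]
  congr 3
  simp [map_ofNat]

/-- The conjugate is a solution for the same λ with the same behaviour on the positive axis, so
uniqueness applies. This carries the asymptotics over to arg z < 0. -/
theorem conj_upper (z lam : ℂ) : conj (upper (conj z) (conj lam)) = upper z lam := by
  have hs := (isSol_upper (conj lam)).conj_conj
  rw [Complex.conj_conj] at hs
  refine hs.eq_upper ?_ z
  have hU : Tendsto (fun r : ℝ => upper r (conj lam) / leadingTerm r) atTop (𝓝 1) := by
    have := upper_div_leadingTerm_tendsto (conj lam) (θ := 1) (by simp) (by simp)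
      (by simp; positivity)
    simpa using this
  have hc := (Complex.continuous_conj.tendsto _).comp hU
  rw [map_one] at hc
  refine hc.congr' ?_
  filter_upwards [eventually_gt_atTop 0] with r hr
  have : conj (leadingTerm r) = leadingTerm r := by
    rw [conj_leadingTerm, Complex.conj_ofReal]
    rw [Complex.arg_ofReal_of_nonneg hr.le]
    exact Real.pi_pos.ne
  simp [map_div₀, this]

theorem isSubdominantSolution_upper : IsSubdominantSolution upper where
  entire lam z := ((isSol_upper lam).hasDerivAt z).differentiableAt
  ode lam z := by
    have h1 : deriv (fun w => upper w lam) = fun w => upper' w lam :=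
      funext fun w => ((isSol_upper lam).hasDerivAt w).deriv
    rw [iteratedDeriv_succ, iteratedDeriv_one, h1, ((isSol_upper lam).hasDerivAt' z).deriv]
    ring
  asymptotics ε hε K hK := by
    have hpi := Real.pi_pos
    obtain ⟨b, hb⟩ := hK.isBounded.exists_norm_le
    obtain ⟨C, R, hR, h⟩ := upper_asymptotics hε b
    have key : ∀ lam : ℂ, ‖lam‖ ≤ b → ∀ z : ℂ, R ≤ ‖z‖ → 0 ≤ z.arg →
        z.arg ≤ 3 * Real.pi / 5 - ε →
        ∃ r : ℂ, upper z lam = leadingTerm z * (1 + r) ∧ ‖r‖ ≤ C * ‖z‖ ^ (-(1 / 2) : ℝ) := by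
      intro lam hlam z hz h1 h2
      obtain ⟨hM, -, hfar⟩ := h lam hlam z hz h1 h2
      refine ⟨_, ?_, hM⟩
      rw [upper_eq (norm_pos_iff.1 (by linarith)) (by linarith) (by linarith) hfar]
      ring
    refine ⟨C, R, fun lam hlam z hz harg => ?_⟩
    rw [abs_le] at harg
    rcases le_total 0 z.arg with h0 | h0
    · exact key lam (hb lam hlam) z hz h0 harg.2
    · have hne : z.arg ≠ Real.pi := by linarith
      have hac : (conj z).arg = -z.arg := by rw [Complex.arg_conj, if_neg hne]
      obtain ⟨r, hr1, hr2⟩ := key (conj lam) (by rw [RCLike.norm_conj]; exact hb lam hlam)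
        (conj z) (by rwa [RCLike.norm_conj]) (by rw [hac]; linarith) (by rw [hac]; linarith)
      refine ⟨conj r, ?_, by rw [RCLike.norm_conj] at hr2 ⊢; exact hr2⟩
      rw [← conj_upper, hr1, map_mul, conj_leadingTerm (by rw [hac]; linarith),
        Complex.conj_conj]
      simp

theorem IsSubdominantSolution.eq_upper {g : ℂ → ℂ → ℂ} (hg : IsSubdominantSolution g) :
    g = upper := by
  have hpi := Real.pi_pos
  ext z lam
  have hs : IsSol lam (fun z => g z lam) (deriv fun z => g z lam) := by
    refine ⟨fun z => (hg.entire lam z).hasDerivAt, fun z => ?_⟩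
    have hd : Differentiable ℂ (deriv fun z => g z lam) := fun z =>
      ((hg.entire lam).differentiableOn.deriv isOpen_univ).differentiableAt univ_mem
    refine (hd z).hasDerivAt.congr_deriv ?_
    have := hg.ode lam z
    rw [iteratedDeriv_succ, iteratedDeriv_one] at this
    linear_combination -this
  refine hs.eq_upper ?_ z
  obtain ⟨C, R, h⟩ := hg.asymptotics (Real.pi / 5) (by positivity) {lam} isCompact_singleton
  rw [tendsto_iff_norm_sub_tendsto_zero]
  refine squeeze_zero' (Eventually.of_forall fun _ => norm_nonneg _) ?_ (tendsto_rpow_bound C)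
  filter_upwards [eventually_ge_atTop R, eventually_gt_atTop 0] with r hr hr0
  have hn : ‖(r : ℂ)‖ = r := by rw [Complex.norm_real, Real.norm_of_nonneg hr0.le]
  obtain ⟨s, hs1, hs2⟩ := h lam rfl r (by rwa [hn])
    (by rw [Complex.arg_ofReal_of_nonneg hr0.le, abs_zero]; linarith)
  rw [hs1, mul_div_cancel_left₀ _ (leadingTerm_ne_zero (by exact_mod_cast hr0.ne')),
    add_sub_cancel_left]
  rwa [hn] at hs2

/-! ### The Stokes relation -/

theorem fPlus_upper (z lam : ℂ) : fPlus upper z lam = growing z lam := by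
  rw [growing_eq, conj_upper, fPlus]

theorem upper_eq_growing (z lam : ℂ) :
    upper z lam = growing (omega * z) (omega ^ 3 * lam) := by
  rw [← fPlus_upper, fPlus, inv_mul_cancel_left₀ omega_ne_zero,
    inv_mul_cancel_left₀ (pow_ne_zero _ omega_ne_zero)]

theorem hasDerivAt_comp_omega {u u' : ℂ → ℂ} (h : ∀ z, HasDerivAt u (u' z) z) (z : ℂ) :
    HasDerivAt (fun z => u (omega * z)) (omega * u' (omega * z)) z := by
  have := (h _).comp z ((hasDerivAt_id z).const_mul omega)
  refine this.congr_deriv ?_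
  simp [mul_comm]

theorem isSol_fMinus (lam : ℂ) : IsSol lam (fun z => fMinus upper z lam)
    (fun z => omega * upper' (omega * z) (omega ^ 3 * lam)) := by
  refine ⟨hasDerivAt_comp_omega (isSol_upper _).hasDerivAt, fun z =>
    ((hasDerivAt_comp_omega (isSol_upper (omega ^ 3 * lam)).hasDerivAt' z).const_mul
      omega).congr_deriv ?_⟩
  rw [fMinus]
  linear_combination (upper (omega * z) (omega ^ 3 * lam) * (z ^ 3 + lam)) * omega_pow_five

theorem upper'_eq_growing' (z lam : ℂ) :
    upper' z lam = omega * growing' (omega * z) (omega ^ 3 * lam) := by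
  have h := hasDerivAt_comp_omega (isSol_growing (omega ^ 3 * lam)).hasDerivAt z
  simp only [← upper_eq_growing] at h
  exact ((isSol_upper lam).hasDerivAt z).unique h

/-- At the rotated point (ωz, ω³λ) the pair f, f₋ becomes f₊, f. Exchanging the two gives the sign,
the chain rule the factor ω. -/
theorem upper_fMinus_wronskian (z lam : ℂ) :
    upper z lam * (omega * upper' (omega * z) (omega ^ 3 * lam)) -
      upper' z lam * fMinus upper z lam = -omega * (2 * Complex.I * (alpha ^ 2)⁻¹) := by
  rw [← upper_growing_wronskian (omega * z) (omega ^ 3 * lam), fMinus, upper'_eq_growing' z,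
    upper_eq_growing z]
  ring

/-- The coefficient ω is exactly the one for which the Wronskian of f with f₋ + ωf₊ vanishes. -/
theorem exists_stokes (lam : ℂ) : ∃ c : ℂ, ∀ z : ℂ,
    fMinus upper z lam + omega * fPlus upper z lam = c * upper z lam := by
  obtain ⟨z₀, h0⟩ := exists_upper_ne_zero lam
  have h := (isSol_upper lam).exists_eq_const_mul
    ((isSol_fMinus lam).add ((isSol_growing lam).const_mul omega)) (x := 0) ?_ h0
  · simpa only [fPlus_upper] using h
  · linear_combination upper_fMinus_wronskian 0 lam + omega * upper_growing_wronskian 0 lam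

/-- Together the two relations read (γ + ω)f₊ = c·f, and the nonzero Wronskian of f and f₊ kills
both coefficients. -/
theorem eq_neg_omega_of_fMinus_eq {lam γ c : ℂ}
    (h : ∀ z, fMinus upper z lam = γ * fPlus upper z lam)
    (hc : ∀ z, fMinus upper z lam + omega * fPlus upper z lam = c * upper z lam) :
    γ = -omega ∧ c = 0 := by
  simp only [fPlus_upper] at h hc
  have h1 : ∀ z, (γ + omega) * growing z lam = c * upper z lam := fun z => by
    rw [← hc, h]; ring
  have h2 : ∀ z, (γ + omega) * growing' z lam = c * upper' z lam := fun z => by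
    have e := ((isSol_growing lam).hasDerivAt z).const_mul (γ + omega)
    simp only [h1] at e
    exact e.unique (((isSol_upper lam).hasDerivAt z).const_mul c)
  have hW := upper_growing_wronskian 0 lam
  have hne := upper_growing_wronskian_ne_zero
  have e1 : (γ + omega) * (2 * Complex.I * (alpha ^ 2)⁻¹) = 0 := by
    rw [← hW]
    linear_combination upper 0 lam * h2 0 - upper' 0 lam * h1 0
  have e2 : c * (2 * Complex.I * (alpha ^ 2)⁻¹) = 0 := by
    rw [← hW]
    linear_combination growing 0 lam * h2 0 - growing' 0 lam * h1 0
  constructor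
  · linear_combination (mul_eq_zero.1 e1).resolve_right hne
  · exact (mul_eq_zero.1 e2).resolve_right hne

/-! ### Decay along rays and restriction to the real line -/

theorem conj_upper' (z lam : ℂ) : conj (upper' (conj z) (conj lam)) = upper' z lam := by
  have h := hasDerivAt_conj_conj_comp (isSol_upper (conj lam)).hasDerivAt z
  simp only [conj_upper] at h
  exact h.unique ((isSol_upper lam).hasDerivAt z)

theorem exists_bound_of_eventually {g : ℝ → ℂ} (hg : Continuous g) {R K : ℝ}
    (h : ∀ x, R ≤ x → ‖g x‖ ≤ K * Real.exp (-x)) :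
    ∃ C, ∀ x, 0 ≤ x → ‖g x‖ ≤ C * Real.exp (-x) := by
  have hc : Continuous fun x => ‖g x‖ * Real.exp x := by fun_prop
  obtain ⟨C, hC⟩ := (isCompact_Icc (a := (0 : ℝ)) (b := R)).exists_bound_of_continuousOn
    hc.continuousOn
  refine ⟨max C K, fun x hx => ?_⟩
  have he := Real.exp_pos x
  rcases le_total x R with hxR | hxR
  · have h1 := hC x ⟨hx, hxR⟩
    rw [Real.norm_of_nonneg (by positivity)] at h1
    rw [Real.exp_neg, ← div_eq_mul_inv, le_div_iff₀ he]
    exact h1.trans (le_max_left _ _)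
  · refine (h x hxR).trans ?_
    gcongr
    exact le_max_right _ _

namespace IsSol

variable {lam : ℂ} {u u' : ℂ → ℂ}

theorem continuous (hu : IsSol lam u u') : Continuous u :=
  continuous_iff_continuousAt.2 fun z => (hu.hasDerivAt z).continuousAt

theorem continuous' (hu : IsSol lam u u') : Continuous u' :=
  continuous_iff_continuousAt.2 fun z => (hu.hasDerivAt' z).continuousAt

end IsSol

theorem upper_ray_decay (lam : ℂ) {θ : ℂ} (hθ : ‖θ‖ = 1) (h1 : 0 ≤ θ.arg)
    (h2 : θ.arg ≤ Real.pi / 10) : ∃ C, ∀ r : ℝ, 0 ≤ r →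
      ‖upper (θ * r) lam‖ ≤ C * Real.exp (-r) ∧ ‖upper' (θ * r) lam‖ ≤ C * Real.exp (-r) := by
  obtain ⟨R, hR, h⟩ := upper_decay lam
  have key : ∀ r : ℝ, R ≤ r → ‖upper (θ * r) lam‖ ≤ 10 * Real.exp (-r) ∧
      ‖upper' (θ * r) lam‖ ≤ 10 * Real.exp (-r) := by
    intro r hr
    have hr0 : 0 < r := by linarith
    have hn : ‖θ * r‖ = r := by
      rw [norm_mul, hθ, one_mul, Complex.norm_real, Real.norm_of_nonneg hr0.le]
    have := h (θ * r) (by rwa [hn]) (by rwa [Complex.arg_mul_real hr0])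
      (by rwa [Complex.arg_mul_real hr0])
    rwa [hn] at this
  obtain ⟨C, hC⟩ := exists_bound_of_eventually (g := fun r : ℝ => upper (θ * r) lam)
    ((isSol_upper lam).continuous.comp (by fun_prop)) fun r hr => (key r hr).1
  obtain ⟨C', hC'⟩ := exists_bound_of_eventually (g := fun r : ℝ => upper' (θ * r) lam)
    ((isSol_upper lam).continuous'.comp (by fun_prop)) fun r hr => (key r hr).2
  refine ⟨max C C', fun r hr => ⟨(hC r hr).trans ?_, (hC' r hr).trans ?_⟩⟩
  · gcongr; exact le_max_left _ _
  · gcongr; exact le_max_right _ _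

theorem arg_alpha : alpha.arg = Real.pi / 10 := by
  have hpi := Real.pi_pos
  have e : Complex.I * Real.pi / 10 = ((Real.pi / 10 : ℝ) : ℂ) * Complex.I := by
    push_cast; ring
  rw [← Complex.log_im, alpha, e, Complex.log_exp]
  · simp
  · rw [Complex.im_ofReal_mul, Complex.I_im]; linarith
  · rw [Complex.im_ofReal_mul, Complex.I_im]; linarith

/-- Since ω⁻¹i = α and ω⁻³ = −α⁻², passing from f₊ to ψ₊ is the substitution z ↦ iz, which turns the
potential z³ + λ into that of Hu = λu. -/
theorem psiPlus_eq (f : ℂ → ℂ → ℂ) (z lam : ℂ) :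
    psiPlus f z lam = fPlus f (Complex.I * z) lam := by
  have h0 := alpha_ne_zero
  have h10 := alpha_pow_ten
  have e1 : omega⁻¹ * (Complex.I * z) = alpha * z := by
    rw [omega_eq, ← alpha_pow_five]; field_simp
  have e2 : (omega ^ 3)⁻¹ * lam = -(alpha ^ 2)⁻¹ * lam := by
    rw [omega_eq, show (alpha ^ 4) ^ 3 = alpha ^ 10 * alpha ^ 2 by ring, h10]
    rw [neg_one_mul, inv_neg]
  rw [psiPlus, fPlus, e1, e2]

theorem psiMinus_eq (f : ℂ → ℂ → ℂ) (z lam : ℂ) :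
    psiMinus f z lam = fMinus f (Complex.I * z) lam := by
  have h0 := alpha_ne_zero
  have h10 := alpha_pow_ten
  have e1 : omega * (Complex.I * z) = -alpha⁻¹ * z := by
    rw [omega_eq, ← alpha_pow_five]
    field_simp
    linear_combination z * h10
  have e2 : omega ^ 3 * lam = -alpha ^ 2 * lam := by
    rw [omega_eq]
    linear_combination alpha ^ 2 * lam * h10
  rw [psiMinus, fMinus, e1, e2]

theorem forall_psi_iff {f : ℂ → ℂ → ℂ} {lam γ : ℂ} :
    (∀ z, psiMinus f z lam = γ * psiPlus f z lam) ↔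
      ∀ z, fMinus f z lam = γ * fPlus f z lam := by
  simp only [psiMinus_eq, psiPlus_eq]
  constructor
  · intro h z
    have := h (-Complex.I * z)
    rwa [← mul_assoc, show Complex.I * -Complex.I = 1 by simp, one_mul] at this
  · exact fun h z => h _

/-- `u` solves `-u'' + i x³ u = lam u` on the line, with derivative `u'`. -/
structure IsRealSol (lam : ℂ) (u u' : ℝ → ℂ) : Prop where
  contDiff : ContDiff ℝ ((⊤ : ℕ∞) : WithTop ℕ∞) u
  contDiff' : ContDiff ℝ ((⊤ : ℕ∞) : WithTop ℕ∞) u'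
  hasDerivAt : ∀ x : ℝ, HasDerivAt u (u' x) x
  hasDerivAt' : ∀ x : ℝ, HasDerivAt u' ((Complex.I * (x : ℂ) ^ 3 - lam) * u x) x

theorem contDiff_restrict {u u' : ℂ → ℂ} (hu : ∀ z, HasDerivAt u (u' z) z) :
    ContDiff ℝ ((⊤ : ℕ∞) : WithTop ℕ∞) (fun x : ℝ => u (Complex.I * x)) := by
  have h1 : ContDiff ℂ ((⊤ : ℕ∞) : WithTop ℕ∞) u :=
    Differentiable.contDiff fun z => (hu z).differentiableAt
  exact (h1.restrict_scalars ℝ).comp (contDiff_const.mul Complex.ofRealCLM.contDiff)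

theorem hasDerivAt_restrict {u u' : ℂ → ℂ} (hu : ∀ z, HasDerivAt u (u' z) z) (x : ℝ) :
    HasDerivAt (fun x : ℝ => u (Complex.I * x)) (Complex.I * u' (Complex.I * x)) x := by
  have h1 : HasDerivAt (fun x : ℝ => Complex.I * (x : ℂ)) (Complex.I * 1) x :=
    (Complex.ofRealCLM.hasDerivAt (x := x)).const_mul Complex.I
  exact ((hu _).comp x h1).congr_deriv (by ring)

theorem IsSol.isRealSol {lam : ℂ} {u u' : ℂ → ℂ} (hu : IsSol lam u u') :
    IsRealSol lam (fun x => u (Complex.I * x)) (fun x => Complex.I * u' (Complex.I * x)) where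
  contDiff := contDiff_restrict hu.hasDerivAt
  contDiff' := contDiff_const.mul (contDiff_restrict hu.hasDerivAt')
  hasDerivAt := hasDerivAt_restrict hu.hasDerivAt
  hasDerivAt' x := by
    refine ((hasDerivAt_restrict hu.hasDerivAt' x).const_mul Complex.I).congr_deriv ?_
    linear_combination (Complex.I ^ 3 * x ^ 3 * u (Complex.I * x) - Complex.I * x ^ 3 *
      u (Complex.I * x) + lam * u (Complex.I * x)) * Complex.I_sq

/-- For x ≥ 0 this is f on the ray of angle π/10, inside the sector of exponential decay. -/
theorem growing_decay (lam : ℂ) : ∃ C, ∀ x : ℝ, 0 ≤ x →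
    ‖growing (Complex.I * x) lam‖ ≤ C * Real.exp (-x) ∧
    ‖Complex.I * growing' (Complex.I * x) lam‖ ≤ C * Real.exp (-x) := by
  have hpi := Real.pi_pos
  set ν := -(alpha ^ 2)⁻¹ * lam with hν
  have e : ∀ z, growing (Complex.I * z) lam = upper (alpha * z) ν := fun z => by
    rw [← fPlus_upper, ← psiPlus_eq, psiPlus]
  obtain ⟨C, hC⟩ := upper_ray_decay ν norm_alpha (by rw [arg_alpha]; positivity) arg_alpha.le
  refine ⟨C, fun x hx => ⟨by rw [e]; exact (hC x hx).1, ?_⟩⟩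
  have h1 := hasDerivAt_restrict (isSol_growing lam).hasDerivAt x
  simp only [e] at h1
  have h2 : HasDerivAt (fun x : ℝ => upper (alpha * x) ν) (alpha * upper' (alpha * x) ν) x := by
    have h3 : HasDerivAt (fun x : ℝ => alpha * (x : ℂ)) (alpha * 1) x :=
      (Complex.ofRealCLM.hasDerivAt (x := x)).const_mul alpha
    exact (((isSol_upper ν).hasDerivAt _).comp x h3).congr_deriv (by ring)
  rw [h1.unique h2, norm_mul, norm_alpha, one_mul]
  exact (hC x hx).2

/-- For x ≤ 0 the argument lies on the ray of angle −π/10, which conjugation moves to angle π/10. -/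
theorem fMinus_decay (lam : ℂ) : ∃ C, ∀ x : ℝ, x ≤ 0 →
    ‖fMinus upper (Complex.I * x) lam‖ ≤ C * Real.exp x ∧
    ‖Complex.I * (omega * upper' (omega * (Complex.I * x)) (omega ^ 3 * lam))‖ ≤
      C * Real.exp x := by
  have hpi := Real.pi_pos
  obtain ⟨C, hC⟩ := upper_ray_decay (conj (omega ^ 3 * lam)) norm_alpha
    (by rw [arg_alpha]; positivity) arg_alpha.le
  have e : ∀ x : ℝ, conj (omega * (Complex.I * x)) = alpha * (-x : ℝ) := fun x => by
    have h0 := alpha_ne_zero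
    have h10 := alpha_pow_ten
    simp only [map_mul, map_pow, conj_alpha, Complex.conj_ofReal, omega_eq, ← alpha_pow_five]
    push_cast
    field_simp
    linear_combination x * h10
  refine ⟨C, fun x hx => ?_⟩
  have h := hC (-x) (by linarith)
  rw [neg_neg] at h
  constructor
  · rw [fMinus, ← conj_upper, RCLike.norm_conj, e]
    exact h.1
  · rw [norm_mul, norm_mul, Complex.norm_I, norm_omega, one_mul, one_mul, ← conj_upper',
      RCLike.norm_conj, e]
    exact h.2

/-! ### Zeros of `f(0, ·)` -/

theorem integrableOn_of_exp_bound {g : ℝ → ℂ} (hg : Continuous g) {C : ℝ}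
    (h : ∀ x, 0 ≤ x → ‖g x‖ ≤ C * Real.exp (-x)) : IntegrableOn g (Ioi 0) := by
  refine Integrable.mono' ((integrableOn_exp_neg_Ioi 0).const_mul C)
    hg.aestronglyMeasurable ?_
  exact (ae_restrict_mem measurableSet_Ioi).mono fun x hx => h x (le_of_lt hx)

/-- The Dirichlet problem for `-u'' + x³ u = -lam u` on the half line is self-adjoint and
positive, so that a zero of `f(0, ·)` is a non-positive real number. -/
theorem exists_nonpos_of_upper_zero {lam : ℂ} (h0 : upper 0 lam = 0) :
    ∃ a : ℝ, a ≤ 0 ∧ lam = a := by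
  have hpi := Real.pi_pos
  obtain ⟨C, hC⟩ := upper_ray_decay lam (θ := 1) (by simp) (by simp) (by simp; positivity)
  simp only [one_mul] at hC
  have hC0 : 0 ≤ C := by
    have := (norm_nonneg _).trans (hC 0 le_rfl).1
    simpa using this
  set u : ℝ → ℂ := fun r => upper r lam with hu
  set v : ℝ → ℂ := fun r => upper' r lam with hv
  have hof : ∀ r : ℝ, HasDerivAt (fun r : ℝ => (r : ℂ)) 1 r := fun r =>
    Complex.ofRealCLM.hasDerivAt
  have hdu : ∀ r : ℝ, HasDerivAt u (v r) r := fun r =>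
    (((isSol_upper lam).hasDerivAt _).comp r (hof r)).congr_deriv (by simp [hv])
  have hdv : ∀ r : ℝ, HasDerivAt v ((((r : ℂ)) ^ 3 + lam) * u r) r := fun r =>
    (((isSol_upper lam).hasDerivAt' _).comp r (hof r)).congr_deriv (by simp [hu])
  have hcu : Continuous u := continuous_iff_continuousAt.2 fun r => (hdu r).continuousAt
  have hcv : Continuous v := continuous_iff_continuousAt.2 fun r => (hdv r).continuousAt
  have hprod : ∀ {a b : ℝ → ℂ}, (∀ r, 0 ≤ r → ‖a r‖ ≤ C * Real.exp (-r)) →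
      (∀ r, 0 ≤ r → ‖b r‖ ≤ C * Real.exp (-r)) → ∀ r, 0 ≤ r →
      ‖a r * b r‖ ≤ C * C * (Real.exp (-r) * Real.exp (-r)) := by
    intro a b ha hb r hr
    rw [norm_mul]
    calc _ ≤ (C * Real.exp (-r)) * (C * Real.exp (-r)) := by
          have := ha r hr
          have := hb r hr
          gcongr
      _ = _ := by ring
  have hbu : ∀ r, 0 ≤ r → ‖u r‖ ≤ C * Real.exp (-r) := fun r hr => (hC r hr).1
  have hbv : ∀ r, 0 ≤ r → ‖v r‖ ≤ C * Real.exp (-r) := fun r hr => (hC r hr).2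
  have hbcu : ∀ r, 0 ≤ r → ‖conj (u r)‖ ≤ C * Real.exp (-r) := fun r hr => by
    rw [RCLike.norm_conj]; exact hbu r hr
  have hbcv : ∀ r, 0 ≤ r → ‖conj (v r)‖ ≤ C * Real.exp (-r) := fun r hr => by
    rw [RCLike.norm_conj]; exact hbv r hr
  have he1 : ∀ r : ℝ, 0 ≤ r → Real.exp (-r) ≤ 1 := fun r hr => by simpa using hr
  have hle : ∀ r : ℝ, 0 ≤ r → C * C * (Real.exp (-r) * Real.exp (-r)) ≤
      C * C * Real.exp (-r) := fun r hr => by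
    have h1 := Real.exp_pos (-r)
    have h2 := he1 r hr
    gcongr
    nlinarith
  have i1 : IntegrableOn (fun r => conj (v r) * v r) (Ioi 0) :=
    integrableOn_of_exp_bound (by fun_prop) (C := C * C) fun r hr =>
      (hprod hbcv hbv r hr).trans (hle r hr)
  have i2 : IntegrableOn (fun r => conj (u r) * u r) (Ioi 0) :=
    integrableOn_of_exp_bound (by fun_prop) (C := C * C) fun r hr =>
      (hprod hbcu hbu r hr).trans (hle r hr)
  have i3 : IntegrableOn (fun r : ℝ => (r : ℂ) ^ 3 * (conj (u r) * u r)) (Ioi 0) := by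
    refine integrableOn_of_exp_bound (by fun_prop) (C := 6 * (C * C)) fun r hr => ?_
    have h1 := Real.pow_div_factorial_le_exp r hr 3
    have h2 : Real.exp r * Real.exp (-r) = 1 := by rw [← Real.exp_add]; simp
    have h3 := Real.exp_pos (-r)
    have h4 : r ^ 3 ≤ 6 * Real.exp r := by
      rw [div_le_iff₀ (by positivity)] at h1
      norm_num [Nat.factorial] at h1
      linarith
    rw [norm_mul, norm_pow, Complex.norm_real, Real.norm_of_nonneg hr]
    calc _ ≤ 6 * Real.exp r * (C * C * (Real.exp (-r) * Real.exp (-r))) := by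
          have := hprod hbcu hbu r hr
          gcongr
      _ = 6 * (C * C) * (Real.exp r * Real.exp (-r)) * Real.exp (-r) := by ring
      _ = _ := by rw [h2, mul_one]
  have hderiv : ∀ r ∈ Ici (0 : ℝ), HasDerivAt (fun r => conj (u r) * v r)
      (conj (v r) * v r + (r : ℂ) ^ 3 * (conj (u r) * u r) + lam * (conj (u r) * u r)) r := by
    intro r _
    have h1 : HasDerivAt (fun r => conj (u r)) (conj (v r)) r := by
      simpa using (hdu r).star
    refine (h1.mul (hdv r)).congr_deriv ?_
    ring
  have hlim : Tendsto (fun r => conj (u r) * v r) atTop (𝓝 0) := by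
    have h1 : Tendsto (fun r : ℝ => C * C * Real.exp (-r)) atTop (𝓝 0) := by
      simpa using (Real.tendsto_exp_neg_atTop_nhds_zero).const_mul (C * C)
    refine squeeze_zero_norm' ?_ h1
    filter_upwards [eventually_ge_atTop (0 : ℝ)] with r hr
    exact (hprod hbcu hbv r hr).trans (hle r hr)
  have hu0 : u 0 = 0 := by simpa [hu] using h0
  -- Integrating (ū u')' over the half line, with u(0) = 0 and decay at infinity, gives ∫|u'|² +
  -- ∫r³|u|² + λ∫|u|² = 0.
  have hmain := integral_Ioi_of_hasDerivAt_of_tendsto' hderiv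
    ((i1.add i3).add (i2.const_mul lam)) hlim
  rw [hu0, map_zero, zero_mul, sub_zero] at hmain
  have hsplit : (∫ r in Ioi (0 : ℝ), conj (v r) * v r) +
      (∫ r in Ioi (0 : ℝ), (r : ℂ) ^ 3 * (conj (u r) * u r)) +
      lam * ∫ r in Ioi (0 : ℝ), conj (u r) * u r = 0 := by
    rw [← hmain, ← integral_const_mul, ← integral_add i1 i3]
    exact (integral_add (i1.add i3) (i2.const_mul lam)).symm
  have r1 : ∫ r in Ioi (0 : ℝ), conj (v r) * v r =
      ((∫ r in Ioi (0 : ℝ), ‖v r‖ ^ 2 : ℝ) : ℂ) := by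
    rw [← integral_complex_ofReal]
    congr 1; ext r
    rw [Complex.conj_mul']; push_cast; rfl
  have r2 : ∫ r in Ioi (0 : ℝ), conj (u r) * u r =
      ((∫ r in Ioi (0 : ℝ), ‖u r‖ ^ 2 : ℝ) : ℂ) := by
    rw [← integral_complex_ofReal]
    congr 1; ext r
    rw [Complex.conj_mul']; push_cast; rfl
  have r3 : ∫ r in Ioi (0 : ℝ), (r : ℂ) ^ 3 * (conj (u r) * u r) =
      ((∫ r in Ioi (0 : ℝ), r ^ 3 * ‖u r‖ ^ 2 : ℝ) : ℂ) := by
    rw [← integral_complex_ofReal]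
    congr 1; ext r
    rw [Complex.conj_mul']; push_cast; rfl
  set A := ∫ r in Ioi (0 : ℝ), ‖v r‖ ^ 2 with hA
  set B := ∫ r in Ioi (0 : ℝ), ‖u r‖ ^ 2 with hB
  set D := ∫ r in Ioi (0 : ℝ), r ^ 3 * ‖u r‖ ^ 2 with hD
  rw [r1, r2, r3] at hsplit
  have hA0 : 0 ≤ A := setIntegral_nonneg measurableSet_Ioi fun r _ => by positivity
  have hD0 : 0 ≤ D := setIntegral_nonneg measurableSet_Ioi fun r hr => by
    have : (0 : ℝ) < r := hr
    positivity
  have hB0 : 0 ≤ B := setIntegral_nonneg measurableSet_Ioi fun r _ => by positivity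
  have hBne : B ≠ 0 := by
    intro hBz
    have hint : IntegrableOn (fun r => ‖u r‖ ^ 2) (Ioi 0) := by
      refine i2.norm.congr (ae_of_all _ fun r => ?_)
      simp [pow_two]
    rw [hB, setIntegral_eq_zero_iff_of_nonneg_ae (ae_of_all _ fun r => by positivity) hint] at hBz
    have hz : EqOn (fun r => ‖u r‖ ^ 2) 0 (Ioi 0) :=
      Measure.eqOn_open_of_ae_eq hBz isOpen_Ioi (by fun_prop) continuousOn_const
    have hU : Tendsto (fun r : ℝ => upper r lam / leadingTerm r) atTop (𝓝 1) := by
      have := upper_div_leadingTerm_tendsto lam (θ := 1) (by simp) (by simp)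
        (by simp; positivity)
      simpa using this
    refine one_ne_zero (tendsto_nhds_unique hU (tendsto_const_nhds.congr' ?_) : (1 : ℂ) = 0)
    filter_upwards [eventually_gt_atTop (0 : ℝ)] with r hr
    have h1 : ‖u r‖ ^ 2 = 0 := hz hr
    have h2 : upper r lam = 0 := norm_eq_zero.1 (pow_eq_zero_iff two_ne_zero |>.1 h1)
    rw [h2, zero_div]
  have hBpos : 0 < B := lt_of_le_of_ne hB0 (Ne.symm hBne)
  refine ⟨-(A + D) / B, div_nonpos_of_nonpos_of_nonneg (by linarith) hB0, ?_⟩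
  have hBc : (B : ℂ) ≠ 0 := by exact_mod_cast hBne
  push_cast
  rw [eq_div_iff hBc]
  linear_combination hsplit

/-- A zero is a non-positive real number. A negative one has argument π, which δ excludes; ‖λ‖ ≥ 1
serves only to exclude 0, whose argument is 0 by convention. -/
theorem upper_zero_ne_zero {lam : ℂ} {δ : ℝ} (hδ : 0 < δ) (h : |lam.arg| ≤ Real.pi - δ)
    (h1 : 1 ≤ ‖lam‖) : upper 0 lam ≠ 0 := by
  intro h0
  obtain ⟨a, ha, rfl⟩ := exists_nonpos_of_upper_zero h0
  have ha' : a < 0 := lt_of_le_of_ne ha fun h => by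
    rw [h] at h1
    norm_num at h1
  rw [Complex.arg_ofReal_of_neg ha', abs_of_pos Real.pi_pos] at h
  linarith

/-! ### Weak solutions -/

/-- A locally integrable function whose distributional derivative vanishes is constant. -/
theorem exists_ae_eq_const {g : ℝ → ℂ} (hg : LocallyIntegrable g)
    (h : ∀ φ : ℝ → ℝ, IsTestFunction φ → ∫ x, ((deriv φ x : ℝ) : ℂ) * g x = 0) :
    ∃ c : ℂ, ∀ᵐ x : ℝ, g x = c := by
  let b : ContDiffBump (0 : ℝ) := default
  set ρ : ℝ → ℝ := b.normed volume with hρ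
  have hρs : ContDiff ℝ ((⊤ : ℕ∞) : WithTop ℕ∞) ρ := b.contDiff_normed
  have hρc : HasCompactSupport ρ := b.hasCompactSupport_normed
  have hρ1 : ∫ x, ρ x = 1 := b.integral_normed
  have hint : ∀ {χ : ℝ → ℝ}, Continuous χ → HasCompactSupport χ →
      Integrable fun x => (χ x : ℂ) * g x := fun hc hs => by
    simpa using hg.integrable_smul_left_of_hasCompactSupport hc hs
  refine ⟨∫ x, (ρ x : ℂ) * g x, ?_⟩
  refine ae_eq_of_integral_contDiff_smul_eq hg (locallyIntegrable_const _) ?_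
  intro χ hχs hχc
  set m := ∫ x, χ x with hm
  -- With its mean removed, χ has a compactly supported primitive φ, so the hypothesis reduces ∫χg
  -- to m∫ρg.
  set ζ : ℝ → ℝ := fun x => χ x - m * ρ x with hζ
  have hζs : ContDiff ℝ ((⊤ : ℕ∞) : WithTop ℕ∞) ζ := hχs.sub (contDiff_const.mul hρs)
  have hζc : HasCompactSupport ζ := by
    have h1 : HasCompactSupport fun x => m * ρ x := hρc.mul_left
    exact hχc.sub h1
  have hζi : Integrable ζ := hζs.continuous.integrable_of_hasCompactSupport hζc
  have hζ0 : ∫ x, ζ x = 0 := by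
    rw [hζ, integral_sub (hχs.continuous.integrable_of_hasCompactSupport hχc)
      ((hρs.continuous.integrable_of_hasCompactSupport hρc).const_mul m), integral_const_mul, hρ1,
      mul_one, hm, sub_self]
  obtain ⟨K, hK⟩ := hζc.isCompact.isBounded.exists_norm_le
  have hsupp : ∀ x, K < |x| → ζ x = 0 := by
    intro x hx
    by_contra hne
    exact absurd (hK x (subset_tsupport _ hne)) (not_le.2 hx)
  set φ : ℝ → ℝ := fun x => ∫ t in Iic x, ζ t with hφ
  have hφd : ∀ x, HasDerivAt φ (ζ x) x := by
    intro x
    have e : ∀ y, φ y = (∫ t in Iic 0, ζ t) + ∫ t in (0 : ℝ)..y, ζ t := fun y => by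
      rw [← intervalIntegral.integral_Iic_sub_Iic hζi.integrableOn hζi.integrableOn]
      ring
    rw [show φ = fun y => (∫ t in Iic 0, ζ t) + ∫ t in (0 : ℝ)..y, ζ t from funext e]
    exact (intervalIntegral.integral_hasDerivAt_right
      (hζs.continuous.intervalIntegrable _ _)
      (hζs.continuous.stronglyMeasurableAtFilter _ _) hζs.continuous.continuousAt).const_add _
  have hderiv : deriv φ = ζ := funext fun x => (hφd x).deriv
  have hφs : ContDiff ℝ ((⊤ : ℕ∞) : WithTop ℕ∞) φ := by
    rw [contDiff_infty_iff_deriv]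
    exact ⟨fun x => (hφd x).differentiableAt, by rw [hderiv]; exact hζs⟩
  have hφc : HasCompactSupport φ := by
    refine HasCompactSupport.intro (isCompact_Icc (a := -(|K| + 1)) (b := |K| + 1)) fun x hx => ?_
    have hKK := le_abs_self K
    rw [mem_Icc, not_and_or, not_le, not_le] at hx
    rcases hx with hx | hx
    · refine setIntegral_eq_zero_of_forall_eq_zero fun t ht => hsupp t ?_
      have ht' : t ≤ x := ht
      have := neg_le_abs t
      linarith
    · have e := setIntegral_eq_integral_of_forall_compl_eq_zero (μ := volume) (s := Iic x)
        (f := ζ) fun t ht => hsupp t (by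
          have ht' : x < t := not_le.1 ht
          have := le_abs_self t
          linarith)
      change ∫ t in Iic x, ζ t = 0
      rw [e, hζ0]
  have h0 := h φ ⟨hφs, hφc⟩
  rw [hderiv] at h0
  have h1 : ∫ x, ((ζ x : ℝ) : ℂ) * g x =
      (∫ x, (χ x : ℂ) * g x) - m * ∫ x, (ρ x : ℂ) * g x := by
    rw [← integral_const_mul, ← integral_sub (hint hχs.continuous hχc)
      ((hint hρs.continuous hρc).const_mul _)]
    refine integral_congr_ae (ae_of_all _ fun x => ?_)
    simp only [hζ]
    push_cast
    ring
  rw [h1, sub_eq_zero] at h0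
  simp only [Complex.real_smul]
  rw [h0, integral_mul_const, integral_complex_ofReal]

theorem integrable_mul_Lp {χ : ℝ → ℂ} (hc : Continuous χ) (hs : HasCompactSupport χ) (u : L2R) :
    Integrable fun x => χ x * u x :=
  (hc.memLp_of_hasCompactSupport (p := 2) hs).integrable_mul (Lp.memLp u)

/-- Weak derivatives may be tested against complex-valued functions. -/
theorem HasWeakDeriv.integral_add_eq_zero {u v : L2R} (h : HasWeakDeriv u v) {χ χ' : ℝ → ℂ}
    (hχ : ContDiff ℝ ((⊤ : ℕ∞) : WithTop ℕ∞) χ) (hd : ∀ x, HasDerivAt χ (χ' x) x)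
    (hs : HasCompactSupport χ) :
    Integrable (fun x => χ' x * u x + χ x * v x) ∧ ∫ x, (χ' x * u x + χ x * v x) = 0 := by
  have hχ' : χ' = deriv χ := funext fun x => (hd x).deriv.symm
  have hc' : Continuous χ' := by rw [hχ']; exact hχ.continuous_deriv (by simp)
  have hs' : HasCompactSupport χ' := by rw [hχ']; exact hs.deriv
  have i1 := integrable_mul_Lp hc' hs' u
  have i2 := integrable_mul_Lp hχ.continuous hs v
  refine ⟨i1.add i2, ?_⟩
  -- Real and imaginary parts of χ are both real test functions, treated at once by a real-linear
  -- functional L.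
  have key : ∀ L : ℂ →L[ℝ] ℝ, (∫ x, ((L (χ' x) : ℝ) : ℂ) * u x) =
      -∫ x, ((L (χ x) : ℝ) : ℂ) * v x := by
    intro L
    have hLd : ∀ x, deriv (fun x => L (χ x)) x = L (χ' x) := fun x =>
      (L.hasFDerivAt.comp_hasDerivAt x (hd x)).deriv
    have := h (fun x => L (χ x)) ⟨L.contDiff.comp hχ, hs.comp_left (map_zero L)⟩
    simpa only [hLd] using this
  have hLi : ∀ L : ℂ →L[ℝ] ℝ, ∀ {η : ℝ → ℂ}, Continuous η → HasCompactSupport η → ∀ w : L2R,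
      Integrable fun x => ((L (η x) : ℝ) : ℂ) * w x := fun L η hc hs w =>
    integrable_test_mul (L.continuous.comp hc) (hs.comp_left (map_zero L)) w
  have hsplit : ∀ {η : ℝ → ℂ}, Continuous η → HasCompactSupport η → ∀ w : L2R,
      ∫ x, η x * w x = (∫ x, ((Complex.reCLM (η x) : ℝ) : ℂ) * w x) +
        Complex.I * ∫ x, ((Complex.imCLM (η x) : ℝ) : ℂ) * w x := by
    intro η hc hs w
    rw [← integral_const_mul, ← integral_add (hLi _ hc hs w) ((hLi _ hc hs w).const_mul _)]
    refine integral_congr_ae (ae_of_all _ fun x => ?_)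
    have := Complex.re_add_im (η x)
    simp only [Complex.reCLM_apply, Complex.imCLM_apply]
    linear_combination -(w x) * this
  rw [integral_add i1 i2, hsplit hc' hs' u, hsplit hχ.continuous hs v, key, key]
  ring

/-- The Wronskian of a weak and a classical solution is constant. -/
theorem weak_wronskian_const {lam : ℂ} {p p' : ℝ → ℂ} (hp : IsRealSol lam p p')
    {u u₁ u₂ : L2R} (h1 : HasWeakDeriv u u₁) (h2 : HasWeakDeriv u₁ u₂)
    (heq : ∀ᵐ x : ℝ, u₂ x = (Complex.I * (x : ℂ) ^ 3 - lam) * u x) :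
    ∃ c : ℂ, ∀ᵐ x : ℝ, u x * p' x - u₁ x * p x = c := by
  have hu : LocallyIntegrable (fun x => u x) (volume : Measure ℝ) :=
    (Lp.memLp u).locallyIntegrable (by norm_num)
  have hu1 : LocallyIntegrable (fun x => u₁ x) (volume : Measure ℝ) :=
    (Lp.memLp u₁).locallyIntegrable (by norm_num)
  have hloc : ∀ {w : ℝ → ℂ} {q : ℝ → ℂ}, LocallyIntegrable w → Continuous q →
      LocallyIntegrable fun x => w x * q x := by
    intro w q hw hq
    rw [← locallyIntegrableOn_univ] at hw ⊢
    exact hw.mul_continuousOn hq.continuousOn isOpen_univ.isLocallyClosed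
  refine exists_ae_eq_const ((hloc hu hp.contDiff'.continuous).sub
    (hloc hu1 hp.contDiff.continuous)) fun φ hφ => ?_
  have hφC : ContDiff ℝ ((⊤ : ℕ∞) : WithTop ℕ∞) fun x => (φ x : ℂ) :=
    Complex.ofRealCLM.contDiff.comp hφ.1
  have hφs : HasCompactSupport fun x => (φ x : ℂ) :=
    hφ.2.comp_left (g := fun r : ℝ => (r : ℂ)) Complex.ofReal_zero
  have hφd : ∀ x, HasDerivAt (fun x => (φ x : ℂ)) ((deriv φ x : ℝ) : ℂ) x := fun x =>
    ((hφ.1.differentiable (by simp)) x).hasDerivAt.ofReal_comp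
  -- Test u against φp' and u₁ against φp. In the difference the terms with p'' and u₂ cancel by the
  -- equation, and those with u₁p' coincide, leaving φ' times the Wronskian.
  obtain ⟨i1, e1⟩ := h1.integral_add_eq_zero (hφC.mul hp.contDiff')
    (fun x => (hφd x).mul (hp.hasDerivAt' x)) hφs.mul_right
  obtain ⟨i2, e2⟩ := h2.integral_add_eq_zero (hφC.mul hp.contDiff)
    (fun x => (hφd x).mul (hp.hasDerivAt x)) hφs.mul_right
  have e3 := integral_sub i1 i2
  rw [e1, e2, sub_zero] at e3
  rw [← e3]
  refine integral_congr_ae ?_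
  filter_upwards [heq] with x hx
  simp only [hx]
  ring

/-- The rate 1/2, half of what the solutions provide, leaves room for the factor x³ in the domain
condition. -/
theorem memLp_of_exp_bound {s : Set ℝ} {g : ℝ → ℂ} (hg : Continuous g)
    {C : ℝ} (h : ∀ x ∈ s, ‖g x‖ ≤ C * Real.exp (-(|x| / 2))) (hs : MeasurableSet s) :
    MemLp g 2 (volume.restrict s) := by
  rw [memLp_two_iff_integrable_sq_norm hg.aestronglyMeasurable]
  have hi : Integrable fun x : ℝ => Real.exp (-|x|) := by
    by_contra hn
    have h1 := integral_comp_abs (f := fun x => Real.exp (-x))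
    rw [integral_undef hn, integral_exp_neg_Ioi_zero] at h1
    norm_num at h1
  refine Integrable.mono' ((hi.const_mul (C ^ 2)).restrict) (by fun_prop) ?_
  refine (ae_restrict_mem hs).mono fun x hx => ?_
  have h1 := h x hx
  have h2 : Real.exp (-|x|) = Real.exp (-(|x| / 2)) ^ 2 := by
    rw [← Real.exp_nat_mul]
    congr 1
    push_cast
    ring
  rw [Real.norm_of_nonneg (by positivity), h2, ← mul_pow]
  gcongr

theorem exp_neg_abs_le {C x : ℝ} (hC : 0 ≤ C) :
    C * Real.exp (-|x|) ≤ C * Real.exp (-(|x| / 2)) := by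
  have := abs_nonneg x
  gcongr
  linarith

/-- A constant Wronskian with a solution decaying on a half line vanishes. -/
theorem ae_wronskian_eq_zero {s : Set ℝ} (hvol : volume s = ⊤)
    {p p' : ℝ → ℂ} (hp : MemLp p 2 (volume.restrict s)) (hp' : MemLp p' 2 (volume.restrict s))
    {u u₁ : L2R} (h : ∃ c : ℂ, ∀ᵐ x : ℝ, u x * p' x - u₁ x * p x = c) :
    ∀ᵐ x : ℝ, u x * p' x = u₁ x * p x := by
  obtain ⟨c, hc⟩ := h
  have i1 : Integrable (fun x => u x * p' x) (volume.restrict s) :=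
    ((Lp.memLp u).restrict s).integrable_mul hp'
  have i2 : Integrable (fun x => u₁ x * p x) (volume.restrict s) :=
    ((Lp.memLp u₁).restrict s).integrable_mul hp
  have i3 : IntegrableOn (fun _ => c) s (volume : Measure ℝ) :=
    (i1.sub i2).congr (ae_restrict_of_ae hc)
  -- A constant integrable over a set of infinite measure is zero.
  rw [integrableOn_const_iff] at i3
  have hc0 : c = 0 := by
    rcases i3 with h | h
    · simpa using h
    · rw [hvol] at h
      exact absurd h (lt_irrefl _)
  filter_upwards [hc] with x hx
  rw [hc0] at hx
  exact sub_eq_zero.1 hx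

/-- Graphs replace the partially defined operators, so that only relations between L² functions
remain. -/
theorem mem_eigen_iff (lam : ℂ) : IsEigenvalue hamiltonian lam ↔
    ∃ u w c : L2R, u ≠ 0 ∧ (u, w) ∈ momentumSqGraph ∧ (u, c) ∈ cubeGraph ∧
      w + Complex.I • c = lam • u := by
  constructor
  · rintro ⟨ψ, h0, hψ⟩
    have hd := ψ.2
    refine ⟨ψ, momentumSq ⟨ψ, hd.1⟩, cubeMul ⟨ψ, hd.2⟩, h0, ?_, ?_, hψ⟩
    · rw [← momentumSq_graph]
      exact momentumSq.mem_graph ⟨ψ, hd.1⟩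
    · rw [← cubeMul_graph]
      exact cubeMul.mem_graph ⟨ψ, hd.2⟩
  · rintro ⟨u, w, c, h0, hw, hc, h⟩
    rw [← momentumSq_graph] at hw
    rw [← cubeMul_graph] at hc
    have hdw : u ∈ momentumSq.domain := LinearPMap.mem_domain_iff.2 ⟨w, hw⟩
    have hdc : u ∈ cubeMul.domain := LinearPMap.mem_domain_iff.2 ⟨c, hc⟩
    have ew : w = momentumSq ⟨u, hdw⟩ := (LinearPMap.image_iff hdw).2 hw
    have ec : c = cubeMul ⟨u, hdc⟩ := (LinearPMap.image_iff hdc).2 hc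
    refine ⟨⟨u, hdw, hdc⟩, h0, ?_⟩
    rw [ew, ec] at h
    exact h

/-- A classical derivative is a weak derivative. -/
theorem hasWeakDeriv_toLp {F F' : ℝ → ℂ} (hd : ∀ x, HasDerivAt F (F' x) x)
    (hF' : Continuous F') (m : MemLp F 2 volume) (m' : MemLp F' 2 volume) :
    HasWeakDeriv (m.toLp F) (m'.toLp F') := by
  intro φ hφ
  have hFc : Continuous F := continuous_iff_continuousAt.2 fun x => (hd x).continuousAt
  have hdc : Continuous (deriv φ) := hφ.1.continuous_deriv (by simp)
  have hi : ∀ {η : ℝ → ℝ} {g : ℝ → ℂ}, Continuous η → HasCompactSupport η → Continuous g →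
      Integrable fun x => g x * (η x : ℂ) := by
    intro η g hη hs hg
    refine Continuous.integrable_of_hasCompactSupport (by fun_prop) ?_
    exact (hs.comp_left (g := fun r : ℝ => (r : ℂ)) Complex.ofReal_zero).mul_left
  have key := integral_mul_deriv_eq_deriv_mul_of_integrable (u := F) (u' := F')
    (v := fun x => (φ x : ℂ)) (v' := fun x => ((deriv φ x : ℝ) : ℂ)) (fun x _ => hd x)
    (fun x _ => ((hφ.1.differentiable (by simp)) x).hasDerivAt.ofReal_comp)
    (hi hdc hφ.2.deriv hFc) (hi hφ.1.continuous hφ.2 hF') (hi hφ.1.continuous hφ.2 hFc)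
  have e1 : ∫ x, ((deriv φ x : ℝ) : ℂ) * m.toLp F x = ∫ x, F x * ((deriv φ x : ℝ) : ℂ) := by
    refine integral_congr_ae ?_
    filter_upwards [m.coeFn_toLp] with x hx
    rw [hx, mul_comm]
  have e2 : ∫ x, (φ x : ℂ) * m'.toLp F' x = ∫ x, F' x * (φ x : ℂ) := by
    refine integral_congr_ae ?_
    filter_upwards [m'.coeFn_toLp] with x hx
    rw [hx, mul_comm]
  rw [e1, e2, key]

theorem isEigenvalue_of_isRealSol {lam : ℂ} {p p' : ℝ → ℂ} (hp : IsRealSol lam p p') {C : ℝ}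
    (hb : ∀ x, ‖p x‖ ≤ C * Real.exp (-|x|)) (hb' : ∀ x, ‖p' x‖ ≤ C * Real.exp (-|x|))
    (hne : ∃ x, p x ≠ 0) : IsEigenvalue hamiltonian lam := by
  have hC : 0 ≤ C := by
    have := (norm_nonneg _).trans (hb 0)
    simpa using this
  have hpc := hp.contDiff.continuous
  have hpc' := hp.contDiff'.continuous
  have mem : ∀ {g : ℝ → ℂ} {K : ℝ}, Continuous g →
      (∀ x, ‖g x‖ ≤ K * Real.exp (-(|x| / 2))) → MemLp g 2 volume := by
    intro g K hg h
    have := memLp_of_exp_bound (s := univ) hg (fun x _ => h x) MeasurableSet.univ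
    rwa [Measure.restrict_univ] at this
  have m0 : MemLp p 2 volume := mem hpc fun x => (hb x).trans (exp_neg_abs_le hC)
  have m1 : MemLp p' 2 volume := mem hpc' fun x => (hb' x).trans (exp_neg_abs_le hC)
  have m3 : MemLp (fun x : ℝ => (x : ℂ) ^ 3 * p x) 2 volume := by
    -- From s³/3! ≤ e^s with s = |x|/2: 48 = 2³ · 3!.
    refine mem (K := 48 * C) (by fun_prop) fun x => ?_
    have hx := abs_nonneg x
    have h1 := Real.pow_div_factorial_le_exp (|x| / 2) (by positivity) 3
    rw [div_le_iff₀ (by positivity)] at h1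
    have h4 : |x| ^ 3 ≤ 48 * Real.exp (|x| / 2) := by
      norm_num [Nat.factorial] at h1
      linarith
    have h5 : Real.exp (|x| / 2) * Real.exp (-|x|) = Real.exp (-(|x| / 2)) := by
      rw [← Real.exp_add]
      ring_nf
    rw [norm_mul, norm_pow, Complex.norm_real, Real.norm_eq_abs]
    calc _ ≤ 48 * Real.exp (|x| / 2) * (C * Real.exp (-|x|)) := by
          have := hb x
          gcongr
      _ = 48 * C * (Real.exp (|x| / 2) * Real.exp (-|x|)) := by ring
      _ = _ := by rw [h5]
  have m2 : MemLp (fun x : ℝ => (Complex.I * (x : ℂ) ^ 3 - lam) * p x) 2 volume := by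
    have := (m3.const_mul Complex.I).sub (m0.const_mul lam)
    refine this.ae_eq (ae_of_all _ fun x => ?_)
    simp only [Pi.sub_apply]
    ring
  have w1 := hasWeakDeriv_toLp hp.hasDerivAt hpc' m0 m1
  have w2 := hasWeakDeriv_toLp hp.hasDerivAt' (by fun_prop) m1 m2
  set P := m0.toLp p with hP
  set P₁ := m1.toLp p' with hP1
  set P₂ := m2.toLp _ with hP2
  set c := m3.toLp _ with hcdef
  have hI2 : ∀ f : L2R, Complex.I • (-Complex.I) • f = f := fun f => by
    rw [smul_smul]
    simp
  have hcomb : P₂ = Complex.I • c - lam • P := by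
    refine Lp.ext ?_
    filter_upwards [m2.coeFn_toLp, m3.coeFn_toLp, m0.coeFn_toLp,
      Lp.coeFn_sub (Complex.I • c) (lam • P), Lp.coeFn_smul Complex.I c,
      Lp.coeFn_smul lam P] with x a1 a2 a3 a4 a5 a6
    rw [a4, Pi.sub_apply, a5, a6, Pi.smul_apply, Pi.smul_apply, a1, a2, a3, smul_eq_mul,
      smul_eq_mul]
    ring
  refine (mem_eigen_iff lam).2 ⟨P, -P₂, c, ?_, ⟨-Complex.I • P₁, ?_, ?_⟩, ?_, ?_⟩
  · intro h0
    obtain ⟨x, hx⟩ := hne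
    have h1 : p =ᵐ[volume] fun _ => (0 : ℂ) := by
      have h2 : (P : ℝ → ℂ) =ᵐ[volume] 0 := by rw [h0]; exact Lp.coeFn_zero _ _ _
      exact m0.coeFn_toLp.symm.trans h2
    exact hx (congrFun ((Continuous.ae_eq_iff_eq volume hpc continuous_const).1 h1) x)
  · change HasWeakDeriv P (Complex.I • (-Complex.I) • P₁)
    rw [hI2]
    exact w1
  · change HasWeakDeriv (-Complex.I • P₁) (Complex.I • (-P₂))
    have := w2.smul (-Complex.I)
    rwa [show -Complex.I • P₂ = Complex.I • -P₂ by rw [neg_smul, smul_neg]] at this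
  · change ∀ᵐ x : ℝ, c x = (x : ℂ) ^ 3 * P x
    filter_upwards [m3.coeFn_toLp, m0.coeFn_toLp] with x a2 a3
    rw [a2, a3]
  · rw [hcomb]
    abel

/-! ### Eigenvalues and the matching condition -/

theorem exists_growing_ne_zero (lam : ℂ) : ∃ z, growing z lam ≠ 0 := by
  obtain ⟨z, hz⟩ := exists_upper_ne_zero ((omega ^ 3)⁻¹ * lam)
  refine ⟨omega * z, ?_⟩
  rwa [upper_eq_growing, mul_inv_cancel_left₀ (pow_ne_zero _ omega_ne_zero)] at hz

/-- The eigenfunction has zero Wronskian with f₊ by integrability at +∞ and with f₋ by integrability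
at −∞. Were f₊ and f₋ independent, these two linear equations would force it to vanish almost
everywhere. -/
theorem exists_fMinus_eq_of_isEigenvalue {lam : ℂ} (h : IsEigenvalue hamiltonian lam) :
    ∃ γ : ℂ, ∀ z, fMinus upper z lam = γ * fPlus upper z lam := by
  obtain ⟨u, w, c, hu0, ⟨v, hv, hw⟩, hc, heq⟩ := (mem_eigen_iff lam).1 h
  have h1 : HasWeakDeriv u (Complex.I • v) := hv
  have h2 : HasWeakDeriv (Complex.I • v) (Complex.I • (Complex.I • w)) := HasWeakDeriv.smul _ hw
  have hode : ∀ᵐ x : ℝ, (Complex.I • (Complex.I • w) : L2R) x =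
      (Complex.I * (x : ℂ) ^ 3 - lam) * u x := by
    have hc' : ∀ᵐ x : ℝ, c x = (x : ℂ) ^ 3 * u x := hc
    have e : Complex.I • (Complex.I • w) = Complex.I • c - lam • u := by
      rw [← heq, smul_smul, Complex.I_mul_I, neg_one_smul]
      abel
    rw [e]
    filter_upwards [hc', Lp.coeFn_sub (Complex.I • c) (lam • u), Lp.coeFn_smul Complex.I c,
      Lp.coeFn_smul lam u] with x a1 a2 a3 a4
    rw [a2, Pi.sub_apply, a3, a4, Pi.smul_apply, Pi.smul_apply, a1, smul_eq_mul, smul_eq_mul]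
    ring
  have hp := (isSol_growing lam).isRealSol
  have hm := (isSol_fMinus lam).isRealSol
  obtain ⟨C, hC⟩ := growing_decay lam
  obtain ⟨C', hC'⟩ := fMinus_decay lam
  have hC0 : 0 ≤ C := by
    have := (norm_nonneg _).trans (hC 0 le_rfl).1
    simpa using this
  have hC0' : 0 ≤ C' := by
    have := (norm_nonneg _).trans (hC' 0 le_rfl).1
    simpa using this
  have key1 := ae_wronskian_eq_zero (s := Ioi (0 : ℝ)) Real.volume_Ioi
    (memLp_of_exp_bound (C := C) hp.contDiff.continuous (fun x hx => by
      have h0 : 0 < x := hx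
      rw [abs_of_pos h0]
      exact (hC x h0.le).1.trans (by gcongr; linarith)) measurableSet_Ioi)
    (memLp_of_exp_bound (C := C) hp.contDiff'.continuous (fun x hx => by
      have h0 : 0 < x := hx
      rw [abs_of_pos h0]
      exact (hC x h0.le).2.trans (by gcongr; linarith)) measurableSet_Ioi)
    (weak_wronskian_const hp h1 h2 hode)
  have key2 := ae_wronskian_eq_zero (s := Iio (0 : ℝ)) Real.volume_Iio
    (memLp_of_exp_bound (C := C') hm.contDiff.continuous (fun x hx => by
      have h0 : x < 0 := hx
      rw [abs_of_neg h0]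
      exact (hC' x h0.le).1.trans (by gcongr; linarith)) measurableSet_Iio)
    (memLp_of_exp_bound (C := C') hm.contDiff'.continuous (fun x hx => by
      have h0 : x < 0 := hx
      rw [abs_of_neg h0]
      exact (hC' x h0.le).2.trans (by gcongr; linarith)) measurableSet_Iio)
    (weak_wronskian_const hm h1 h2 hode)
  obtain ⟨z₀, hz₀⟩ := exists_growing_ne_zero lam
  have hres := (isSol_growing lam).exists_eq_const_mul (isSol_fMinus lam) (x := 0) ?_ hz₀
  · simpa only [fPlus_upper] using hres
  by_contra hW
  refine hu0 ?_
  rw [Lp.eq_zero_iff_ae_eq_zero]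
  filter_upwards [key1, key2] with x a1 a2
  have hWx := (isSol_growing lam).wronskian (isSol_fMinus lam) (Complex.I * x) 0
  rw [← hWx] at hW
  have hWI := mul_ne_zero Complex.I_ne_zero hW
  refine (mul_eq_zero.1 ?_).resolve_right hWI
  linear_combination growing (Complex.I * x) lam * a2 - fMinus upper (Complex.I * x) lam * a1

/-- Here f₊ decays at +∞, and at −∞ it inherits the decay of f₋; division by γ is allowed because γ
= −ω. -/
theorem isEigenvalue_of_fMinus_eq {lam γ : ℂ}
    (h : ∀ z, fMinus upper z lam = γ * fPlus upper z lam) : IsEigenvalue hamiltonian lam := by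
  obtain ⟨c, hc⟩ := exists_stokes lam
  have hγ : γ ≠ 0 := by
    rw [(eq_neg_omega_of_fMinus_eq h hc).1]
    exact neg_ne_zero.2 omega_ne_zero
  simp only [fPlus_upper] at h
  have h' : ∀ z, omega * upper' (omega * z) (omega ^ 3 * lam) = γ * growing' z lam := fun z => by
    have e := (isSol_fMinus lam).hasDerivAt z
    simp only [h] at e
    exact e.unique (((isSol_growing lam).hasDerivAt z).const_mul γ)
  obtain ⟨C, hC⟩ := growing_decay lam
  obtain ⟨C', hC'⟩ := fMinus_decay lam
  have hγn : 0 < ‖γ‖ := norm_pos_iff.2 hγ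
  have hle : ∀ x : ℝ, ‖growing (Complex.I * x) lam‖ ≤ max C (C' / ‖γ‖) * Real.exp (-|x|) ∧
      ‖Complex.I * growing' (Complex.I * x) lam‖ ≤ max C (C' / ‖γ‖) * Real.exp (-|x|) := by
    intro x
    rcases le_total 0 x with hx | hx
    · rw [abs_of_nonneg hx]
      have hmul : C * Real.exp (-x) ≤ max C (C' / ‖γ‖) * Real.exp (-x) := by
        gcongr; exact le_max_left _ _
      exact ⟨(hC x hx).1.trans hmul, (hC x hx).2.trans hmul⟩
    · rw [abs_of_nonpos hx, neg_neg]
      have hmul : C' / ‖γ‖ * Real.exp x ≤ max C (C' / ‖γ‖) * Real.exp x := by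
        gcongr; exact le_max_right _ _
      obtain ⟨b1, b2⟩ := hC' x hx
      rw [h, norm_mul] at b1
      rw [h', mul_left_comm, norm_mul] at b2
      constructor
      · refine le_trans ?_ hmul
        rw [div_mul_eq_mul_div, le_div_iff₀ hγn, mul_comm]
        exact b1
      · refine le_trans ?_ hmul
        rw [div_mul_eq_mul_div, le_div_iff₀ hγn, mul_comm]
        exact b2
  refine isEigenvalue_of_isRealSol (isSol_growing lam).isRealSol (fun x => (hle x).1)
    (fun x => (hle x).2) ?_
  -- Vanishing on the imaginary axis would make value and derivative zero at the origin, hence the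
  -- whole solution zero.
  by_contra! hz
  have hz' : ∀ x : ℝ, Complex.I * growing' (Complex.I * x) lam = 0 := fun x => by
    have e := (isSol_growing lam).isRealSol.hasDerivAt x
    simp only [hz] at e
    exact e.unique (hasDerivAt_const x 0)
  obtain ⟨z₀, hz₀⟩ := exists_growing_ne_zero lam
  refine hz₀ ((isSol_growing lam).eq_zero (z₀ := Complex.I * (0 : ℝ)) (hz 0) ?_ z₀)
  exact (mul_eq_zero.1 (hz' 0)).resolve_left Complex.I_ne_zero

theorem isEigenvalue_iff (lam : ℂ) : IsEigenvalue hamiltonian lam ↔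
    ∃ γ : ℂ, ∀ z, psiMinus upper z lam = γ * psiPlus upper z lam := by
  simp only [forall_psi_iff]
  exact ⟨exists_fMinus_eq_of_isEigenvalue, fun ⟨_, h⟩ => isEigenvalue_of_fMinus_eq h⟩

end CubicOscillator

/-! ### Assembly of the theorem. -/

theorem mainTheorem4 :
    ∃ f : ℂ → ℂ → ℂ,
      -- `f` is the unique solution with the prescribed asymptotics
      CubicOscillator.IsSubdominantSolution f ∧
      (∀ g : ℂ → ℂ → ℂ, CubicOscillator.IsSubdominantSolution g → g = f) ∧
      -- `C lam` is the Stokes coefficient: the unique `c` with `f₋ + ω f₊ = c f`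
      ∃ C : ℂ → ℂ,
        (∀ lam c : ℂ,
          (∀ z : ℂ, CubicOscillator.fMinus f z lam +
            CubicOscillator.omega * CubicOscillator.fPlus f z lam = c * f z lam) ↔ c = C lam) ∧
        -- (i)
        (∀ lam : ℂ, CubicOscillator.IsEigenvalue CubicOscillator.hamiltonian lam ↔
          ∃ γ : ℂ, ∀ z : ℂ,
            CubicOscillator.psiMinus f z lam = γ * CubicOscillator.psiPlus f z lam) ∧
        -- (ii)
        (∀ lam γ : ℂ,
          (∀ z : ℂ, CubicOscillator.psiMinus f z lam = γ * CubicOscillator.psiPlus f z lam) →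
            γ = -CubicOscillator.omega ∧ C lam = 0) ∧
        -- (iii), necessity of the matching condition at the origin
        (∀ lam : ℂ, CubicOscillator.IsEigenvalue CubicOscillator.hamiltonian lam →
          CubicOscillator.psiMinus f 0 lam =
            -CubicOscillator.omega * CubicOscillator.psiPlus f 0 lam) ∧
        -- (iii), sufficiency of the matching condition for large `lam` in a sector
        (∀ δ : ℝ, 0 < δ → ∃ R : ℝ, ∀ lam : ℂ, |lam.arg| ≤ Real.pi - δ → R ≤ ‖lam‖ →
          CubicOscillator.psiMinus f 0 lam =
            -CubicOscillator.omega * CubicOscillator.psiPlus f 0 lam →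
          CubicOscillator.IsEigenvalue CubicOscillator.hamiltonian lam) := by
  choose C hC using CubicOscillator.exists_stokes
  refine ⟨CubicOscillator.upper, CubicOscillator.isSubdominantSolution_upper,
    fun g hg => hg.eq_upper, C, fun lam c => ⟨fun h => ?_, fun h => h ▸ hC lam⟩,
    CubicOscillator.isEigenvalue_iff, fun lam γ h => ?_, fun lam h => ?_, fun δ hδ =>
      ⟨1, fun lam harg hlam h => ?_⟩⟩
  · obtain ⟨z, hz⟩ := CubicOscillator.exists_upper_ne_zero lam
    exact mul_right_cancel₀ hz ((h z).symm.trans (hC lam z))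
  · exact CubicOscillator.eq_neg_omega_of_fMinus_eq (CubicOscillator.forall_psi_iff.1 h) (hC lam)
  · obtain ⟨γ, hγ⟩ := (CubicOscillator.isEigenvalue_iff lam).1 h
    rw [hγ, (CubicOscillator.eq_neg_omega_of_fMinus_eq (CubicOscillator.forall_psi_iff.1 hγ)
      (hC lam)).1]
  -- At z = 0 the Stokes relation and the matching condition give C(λ) f(0, λ) = 0. Since f(0, λ) ≠
  -- 0 in the sector, already for R = 1, it follows that C(λ) = 0, so f₋ = −ωf₊ everywhere.
  · have h0 := hC lam 0
    rw [CubicOscillator.psiMinus_eq, CubicOscillator.psiPlus_eq, mul_zero] at h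
    have hz : C lam * CubicOscillator.upper 0 lam = 0 := by
      rw [← h0, h]
      ring
    have hC0 := (mul_eq_zero.1 hz).resolve_right
      (CubicOscillator.upper_zero_ne_zero hδ harg hlam)
    refine CubicOscillator.isEigenvalue_of_fMinus_eq (γ := -CubicOscillator.omega) fun z => ?_
    have hz' := hC lam z
    rw [hC0] at hz'
    linear_combination hz'
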